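/- For $\Re a>0$ let $\zeta(s,a)$ be the Hurwitz zeta function, i.e. the analytic continuation of $\sum_{n\ge 0}(n+a)^{-s}$ ($\Re s>1$), let $\zeta^{(r)}(j,a)$ be its $r$-th derivative in $s$ at $s=j$, and let the generalized Stieltjes constants $\gamma_\ell(a)$ be defined by $$\zeta(s,a)=\frac1{s-1}+\sum_{\ell\ge0}\frac{(-1)^\ell}{\ell!}\gamma_\ell(a)(s-1)^\ell .$$ Let $s(n,k)$ be the signed Stirling numbers of the first kind, $x(x+1)\cdots(x+n-1)=\sum_k(-1)^{n-k}s(n,k)x^k$, and let $\ln$ be the principal logarithm. Fix an integer $\ell\ge0$. For complex $a$ with $\Re a>0$ and $|a|\ge1$, and for $0\le k\le\ell$, put $$S_k(\lambda)=\sum_{j=2}^\infty\frac{\lambda^j-(-1)^j}{(\lambda+1)^j}\,\frac{(-1)^{j+1}}{j!}\,s(j,k+1)\,\zeta^{(\ell-k)}(j,a),$$ and consider the formula $$(-1)^\ell\gamma_\ell(a)=(-1)^{\ell+1}\frac{\ln^{\ell+1}\!\left(a-\frac{\lambda}{\lambda+1}\right)}{\ell+1}-\sum_{k=0}^{\ell}\frac{\ell!\,(-1)^k}{(\ell-k)!}\,S_k(\lambda).\qquad(*)$$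 1. For every real $\lambda>0$ (for which $\left|\frac{\lambda}{\lambda+1}\right|<|a|$ holds automatically) the series $S_k(\lambda)$, $0\le k\le\ell$, converge absolutely and $(*)$ holds. 2. Let $\Omega_a=\{\lambda\in\mathbb C:\lambda\ne-1,\ \left|\frac{\lambda}{\lambda+1}\right|<|a|\}$. For every $\lambda\in\Omega_a$ with $\left|\frac1{\lambda+1}\right|\le|a|$ the series $S_k(\lambda)$, $0\le k\le\ell$, converge (as limits of partial sums). The functions $S_k$ so obtained extend to holomorphic functions on the whole of $\Omega_a$, and with these extensions $(*)$ holds for every $\lambda\in\Omega_a$. 3. (Case $\lambda=i$.) For every real $a>1$ all series below converge absolutely, and $$(-1)^\ell\gamma_\ell(a)=(-1)^{\ell+1}\Re\!\left(\frac{\ln^{\ell+1}\!\left(a-\frac12-\frac i2\right)}{\ell+1}\right)-\sum_{k=0}^\ell\frac{\ell!(-1)^k}{(\ell-k)!}\Bigg[\sum_{q=1}^\infty\frac{(-1)^q2^{-2q}}{(4q+1)!}s(4q+1,k+1)\zeta^{(\ell-k)}(4q+1,a)-\sum_{q=0}^\infty\frac{(-1)^q2^{-2q-1}}{(4q+3)!}s(4q+3,k+1)\zeta^{(\ell-k)}(4q+3,a)\Bigg],$$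 $$\sum_{k=0}^\ell\frac{\ell!}{(\ell-k)!}(-1)^k\sum_{r=0}^\infty\frac{(-1/4)^r}{(4r+2)!}\,s(4r+2,k+1)\,\zeta^{(\ell-k)}(4r+2,a)=\Im\!\left((-1)^\ell\,\frac{\ln^{\ell+1}\!\left(a-\frac{1+i}2\right)}{\ell+1}\right).$$ -/

import Mathlib

open Filter Topology MeasureTheory

noncomputable section

namespace HurwitzStieltjes

/-- The `n`-th Euler-Maclaurin correction `∫₀¹ ((n + a)^(-s) - (n + a + t)^(-s)) dt`. -/
def hurwitzTerm (a s : ℂ) (n : ℕ) : ℂ :=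
  ∫ t in (0 : ℝ)..1, (((n : ℂ) + a) ^ (-s) - ((n : ℂ) + a + (t : ℂ)) ^ (-s))

/-- The part of the Hurwitz zeta function that is holomorphic on the whole of `0 < re s`. -/
def hurwitzReg (a s : ℂ) : ℂ := ∑' n : ℕ, hurwitzTerm a s n

/-- The Hurwitz zeta function `ζ(s, a)` for `0 < re a`, analytically continued from `1 < re s`
to `0 < re s`, `s ≠ 1` (the formula is meant for these `s` only). That this is the Dirichlet series
`∑ (n + a)^(-s)` for `1 < re s` is `hasSum_hurwitzZeta`; that it is holomorphic is
`differentiableAt_hurwitzZeta`. -/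
def hurwitzZeta (a s : ℂ) : ℂ := a ^ (1 - s) / (s - 1) + hurwitzReg a s

/-- `ζ^{(r,0)}(j, a)`: the `r`-th derivative in `s` of the Hurwitz zeta function at `s = j`. -/
def hurwitzZetaDeriv (r : ℕ) (j : ℕ) (a : ℂ) : ℂ := iteratedDeriv r (hurwitzZeta a) (j : ℂ)

/-- The generalized Stieltjes constant `γ_ℓ(a)`: `(-1)^ℓ ℓ!` times the coefficient of
`(s - 1)^ℓ` in the Laurent expansion of `ζ(s, a)` at `s = 1`. -/
def stieltjesGamma (l : ℕ) (a : ℂ) : ℂ :=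
  (-1) ^ l * (l.factorial : ℂ) *
    ((2 * (Real.pi : ℂ) * Complex.I)⁻¹ *
      ∮ s in C(1, 1 / 2), hurwitzZeta a s / (s - 1) ^ (l + 1))

/-- The signed Stirling numbers of the first kind,
`x (x + 1) ⋯ (x + n - 1) = ∑ k, (-1)^(n - k) s(n, k) x^k`. -/
def stirlingS (n k : ℕ) : ℤ := (-1) ^ (n + k) * (Nat.stirlingFirst n k : ℤ)

/-- The summand
`(λ^j - (-1)^j) / (λ + 1)^j * (-1)^(j + 1) / j! * s(j, k + 1) * ζ^{(ℓ - k)}(j, a)`. -/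
def lambdaTerm (l : ℕ) (a lam : ℂ) (k j : ℕ) : ℂ :=
  (lam ^ j - (-1) ^ j) / (lam + 1) ^ j * ((-1) ^ (j + 1) / (j.factorial : ℂ)) *
    (stirlingS j (k + 1) : ℂ) * hurwitzZetaDeriv (l - k) j a

/-- The domain of the parameter `λ`: all `λ ≠ -1` with `|λ / (λ + 1)| < |a|`. -/
def lambdaDomain (a : ℂ) : Set ℂ := {lam : ℂ | lam ≠ -1 ∧ ‖lam / (lam + 1)‖ < ‖a‖}

/-! Checks on the definition of `hurwitzZeta`. -/

theorem norm_le_norm_add {w : ℂ} (hw : 0 < w.re) {t : ℝ} (ht : 0 ≤ t) : ‖w‖ ≤ ‖w + (t : ℂ)‖ := by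
  rw [← sq_le_sq₀ (norm_nonneg _) (norm_nonneg _), Complex.sq_norm, Complex.sq_norm,
    Complex.normSq_apply, Complex.normSq_apply]
  simp only [Complex.add_re, Complex.add_im, Complex.ofReal_re, Complex.ofReal_im]
  nlinarith

theorem add_mem_slitPlane {w : ℂ} (hw : 0 < w.re) {t : ℝ} (ht : 0 ≤ t) :
    w + (t : ℂ) ∈ Complex.slitPlane := by
  rw [Complex.mem_slitPlane_iff]
  left
  simp only [Complex.add_re, Complex.ofReal_re]
  linarith

theorem hasDerivAt_add_cpow {w : ℂ} (hw : 0 < w.re) (s : ℂ) {t : ℝ} (ht : 0 ≤ t) :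
    HasDerivAt (fun u : ℝ => (w + (u : ℂ)) ^ s) (s * (w + (t : ℂ)) ^ (s - 1)) t := by
  have h1 : HasDerivAt (fun z : ℂ => w + z) 1 (t : ℂ) := (hasDerivAt_id _).const_add w
  have h2 := (h1.cpow_const (c := s) (add_mem_slitPlane hw ht)).comp_ofReal
  simpa using h2

theorem norm_sub_cpow_le {w : ℂ} (hw : 0 < w.re) {s : ℂ} (hs : 0 < s.re) {t : ℝ}
    (ht : t ∈ Set.Icc (0 : ℝ) 1) :
    ‖w ^ (-s) - (w + (t : ℂ)) ^ (-s)‖ ≤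
      ‖s‖ * (‖w‖ ^ (-s.re - 1) * Real.exp (Real.pi * |s.im|)) := by
  have hw0 : 0 < ‖w‖ := norm_pos_iff.2 (fun h => by simp [h] at hw)
  have hb : ∀ u ∈ Set.Ico (0 : ℝ) 1, ‖-s * (w + (u : ℂ)) ^ (-s - 1)‖ ≤
      ‖s‖ * (‖w‖ ^ (-s.re - 1) * Real.exp (Real.pi * |s.im|)) := by
    intro u hu
    have hle := norm_le_norm_add hw hu.1
    rw [norm_mul, norm_neg,
      Complex.norm_cpow_of_ne_zero (Complex.slitPlane_ne_zero (add_mem_slitPlane hw hu.1)),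
      div_eq_mul_inv, ← Real.exp_neg]
    simp only [Complex.sub_re, Complex.neg_re, Complex.one_re, Complex.sub_im, Complex.neg_im,
      Complex.one_im, sub_zero]
    gcongr ‖s‖ * (?_ * Real.exp ?_)
    · exact Real.rpow_le_rpow_of_nonpos hw0 hle (by linarith)
    · have h1 := Complex.abs_arg_le_pi (w + (u : ℂ))
      calc -((w + (u : ℂ)).arg * -s.im) ≤ |(w + (u : ℂ)).arg * s.im| := by
            simpa using le_abs_self ((w + (u : ℂ)).arg * s.im)
        _ ≤ Real.pi * |s.im| := by rw [abs_mul]; gcongr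
  have h := norm_image_sub_le_of_norm_deriv_le_segment_01'
    (f := fun u : ℝ => (w + ((t * u : ℝ) : ℂ)) ^ (-s))
    (f' := fun u : ℝ => t * (-s * (w + ((t * u : ℝ) : ℂ)) ^ (-s - 1)))
    (C := ‖s‖ * (‖w‖ ^ (-s.re - 1) * Real.exp (Real.pi * |s.im|))) ?_ ?_
  · rw [norm_sub_rev]
    simpa using h
  · intro u hu
    have h1 : HasDerivAt (fun u : ℝ => t * u) t u := by
      simpa using (hasDerivAt_id u).const_mul t
    have h2 := (hasDerivAt_add_cpow hw (-s) (mul_nonneg ht.1 hu.1)).scomp u h1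
    simpa [Function.comp_def] using h2.hasDerivWithinAt
  · intro u hu
    rw [norm_mul]
    have h2 := hb (t * u) ⟨mul_nonneg ht.1 hu.1, by nlinarith [ht.1, ht.2, hu.1, hu.2]⟩
    have h3 : ‖(t : ℂ)‖ ≤ 1 := by simpa [abs_of_nonneg ht.1] using ht.2
    calc _ ≤ 1 * ‖-s * (w + ((t * u : ℝ) : ℂ)) ^ (-s - 1)‖ := by gcongr
      _ ≤ _ := by rw [one_mul]; exact h2

theorem nat_add_re_pos {a : ℂ} (ha : 0 < a.re) (n : ℕ) : 0 < ((n : ℂ) + a).re := by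
  simp only [Complex.add_re, Complex.natCast_re]
  positivity

theorem norm_hurwitzTerm_le {a : ℂ} (ha : 0 < a.re) {s : ℂ} (hs : 0 < s.re) (n : ℕ) :
    ‖hurwitzTerm a s n‖ ≤
      ‖s‖ * (‖(n : ℂ) + a‖ ^ (-s.re - 1) * Real.exp (Real.pi * |s.im|)) := by
  have := intervalIntegral.norm_integral_le_of_norm_le_const
    (a := 0) (b := 1) (f := fun t : ℝ => ((n : ℂ) + a) ^ (-s) - ((n : ℂ) + a + (t : ℂ)) ^ (-s))
    (C := ‖s‖ * (‖(n : ℂ) + a‖ ^ (-s.re - 1) * Real.exp (Real.pi * |s.im|)))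
    (fun t ht => norm_sub_cpow_le (nat_add_re_pos ha n) hs
      (by rw [Set.uIoc_of_le zero_le_one] at ht; exact ⟨ht.1.le, ht.2⟩))
  simpa [hurwitzTerm] using this

theorem summable_bound {a : ℂ} (ha : 0 < a.re) {c : ℝ} (hc : 1 < c) :
    Summable fun n : ℕ => ‖(n : ℂ) + a‖ ^ (-c) := by
  have h := (Real.summable_one_div_nat_add_rpow a.re c).2 hc
  refine h.of_nonneg_of_le (fun n => by positivity) (fun n => ?_)
  have h1 : 0 < (n : ℝ) + a.re := by positivity
  have h2 : (n : ℝ) + a.re ≤ ‖(n : ℂ) + a‖ := by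
    simpa using Complex.re_le_norm ((n : ℂ) + a)
  rw [abs_of_pos h1, one_div, ← Real.rpow_neg h1.le]
  exact Real.rpow_le_rpow_of_nonpos h1 h2 (by linarith)

theorem continuousOn_add_cpow {w : ℂ} (hw : 0 < w.re) (s : ℂ) :
    ContinuousOn (fun t : ℝ => (w + (t : ℂ)) ^ s) (Set.uIcc 0 1) := by
  intro t ht
  rw [Set.uIcc_of_le zero_le_one] at ht
  exact (hasDerivAt_add_cpow hw s ht.1).continuousAt.continuousWithinAt

theorem hurwitzTerm_eq {a : ℂ} (ha : 0 < a.re) {s : ℂ} (hs : s ≠ 1) (n : ℕ) :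
    hurwitzTerm a s n = ((n : ℂ) + a) ^ (-s) -
      (((n : ℂ) + a) ^ (1 - s) - ((n + 1 : ℕ) + a) ^ (1 - s)) / (s - 1) := by
  have hw := nat_add_re_pos ha n
  have hs' : s - 1 ≠ 0 := sub_ne_zero.2 hs
  have hs'' : 1 - s ≠ 0 := sub_ne_zero.2 hs.symm
  rw [hurwitzTerm, intervalIntegral.integral_sub (by simp)
    (continuousOn_add_cpow hw _).intervalIntegrable]
  congr 1
  · simp
  · rw [intervalIntegral.integral_eq_sub_of_hasDerivAt
      (f := fun t : ℝ => ((n : ℂ) + a + (t : ℂ)) ^ (1 - s) / (1 - s)) ?_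
      (continuousOn_add_cpow hw _).intervalIntegrable]
    · have e1 : (n : ℂ) + a + ((1 : ℝ) : ℂ) = ((n + 1 : ℕ) : ℂ) + a := by push_cast; ring
      rw [e1]
      simp only [Complex.ofReal_zero, add_zero]
      field_simp
      ring
    · intro t ht
      rw [Set.uIcc_of_le zero_le_one] at ht
      have := (hasDerivAt_add_cpow hw (1 - s) ht.1).div_const (1 - s)
      convert! this using 1
      rw [show 1 - s - 1 = -s by ring]
      field_simp

/-- For `1 < re s`, `hurwitzZeta a s` is the Hurwitz series. -/
theorem hasSum_hurwitzZeta {a : ℂ} (ha : 0 < a.re) {s : ℂ} (hs : 1 < s.re) :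
    HasSum (fun n : ℕ => 1 / ((n : ℂ) + a) ^ s) (hurwitzZeta a s) := by
  have hs1 : s ≠ 1 := fun h => by simp [h] at hs
  have hne : ∀ n : ℕ, (n : ℂ) + a ≠ 0 := fun n h => by
    have := nat_add_re_pos ha n
    simp [h] at this
  have hnorm : ∀ (n : ℕ) (z : ℂ), ‖((n : ℂ) + a) ^ z‖ ≤
      ‖(n : ℂ) + a‖ ^ z.re * Real.exp (Real.pi * |z.im|) := by
    intro n z
    rw [Complex.norm_cpow_of_ne_zero (hne n), div_eq_mul_inv, ← Real.exp_neg]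
    gcongr
    have h1 := Complex.abs_arg_le_pi ((n : ℂ) + a)
    calc -(((n : ℂ) + a).arg * z.im) ≤ |((n : ℂ) + a).arg * z.im| := neg_le_abs _
      _ ≤ Real.pi * |z.im| := by rw [abs_mul]; gcongr
  have hsum1 : Summable fun n : ℕ => 1 / ((n : ℂ) + a) ^ s := by
    refine Summable.of_norm_bounded
      ((summable_bound ha hs).mul_right (Real.exp (Real.pi * |s.im|))) (fun n => ?_)
    rw [one_div, ← Complex.cpow_neg]
    simpa using hnorm n (-s)
  have hsum2 : Summable (hurwitzTerm a s) := by
    refine Summable.of_norm_bounded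
      (((summable_bound ha (c := s.re + 1) (by linarith)).mul_right
        (Real.exp (Real.pi * |s.im|))).mul_left ‖s‖) (fun n => ?_)
    have := norm_hurwitzTerm_le ha (s := s) (by linarith) n
    rwa [show -s.re - 1 = -(s.re + 1) by ring] at this
  have hlim : Tendsto (fun n : ℕ => ((n : ℂ) + a) ^ (1 - s)) atTop (𝓝 0) := by
    have h1 : Tendsto (fun n : ℕ => ‖(n : ℂ) + a‖) atTop atTop := by
      refine tendsto_atTop_mono (fun n => ?_) (tendsto_natCast_atTop_atTop (R := ℝ))
      have := Complex.re_le_norm ((n : ℂ) + a)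
      simp only [Complex.add_re, Complex.natCast_re] at this
      linarith
    have h2 := ((tendsto_rpow_neg_atTop (y := s.re - 1) (by linarith)).comp h1).mul_const
      (Real.exp (Real.pi * |(1 - s).im|))
    rw [zero_mul] at h2
    refine squeeze_zero_norm (fun n => ?_) h2
    have := hnorm n (1 - s)
    simpa using this
  have htel : HasSum (fun n : ℕ => (((n : ℂ) + a) ^ (1 - s) - ((n + 1 : ℕ) + a) ^ (1 - s)) / (s - 1))
      (a ^ (1 - s) / (s - 1)) := by
    have hs2 : Summable fun n : ℕ =>
        (((n : ℂ) + a) ^ (1 - s) - ((n + 1 : ℕ) + a) ^ (1 - s)) / (s - 1) := by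
      refine (hsum1.sub hsum2).congr (fun n => ?_)
      rw [hurwitzTerm_eq ha hs1, one_div, ← Complex.cpow_neg]
      ring
    refine (hs2.hasSum_iff_tendsto_nat).2 ?_
    have h3 : Tendsto (fun N : ℕ => (a ^ (1 - s) - ((N : ℂ) + a) ^ (1 - s)) / (s - 1)) atTop
        (𝓝 ((a ^ (1 - s) - 0) / (s - 1))) := (hlim.const_sub _).div_const _
    rw [sub_zero] at h3
    refine h3.congr (fun N => ?_)
    rw [← Finset.sum_div, Finset.sum_range_sub' (fun n : ℕ => ((n : ℂ) + a) ^ (1 - s)) N]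
    simp
  refine (htel.add hsum2.hasSum).congr_fun (fun n => ?_)
  rw [hurwitzTerm_eq ha hs1, one_div, ← Complex.cpow_neg]
  ring

theorem differentiableAt_hurwitzTerm {a : ℂ} (ha : 0 < a.re) (s : ℂ) (n : ℕ) :
    DifferentiableAt ℂ (fun s => hurwitzTerm a s n) s := by
  set w : ℂ := (n : ℂ) + a with hw_def
  have hw : 0 < w.re := nat_add_re_pos ha n
  have hne : ∀ t ∈ Set.Icc (0 : ℝ) 1, w + (t : ℂ) ≠ 0 := fun t ht =>
    Complex.slitPlane_ne_zero (add_mem_slitPlane hw ht.1)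
  have hw0 : w ≠ 0 := by simpa using hne 0 (by simp)
  let F' : ℂ → ℝ → ℂ := fun s t =>
    -(w ^ (-s) * Complex.log w) - -((w + (t : ℂ)) ^ (-s) * Complex.log (w + (t : ℂ)))
  have hF' : ContinuousOn (fun p : ℂ × ℝ => F' p.1 p.2)
      (Metric.closedBall s 1 ×ˢ Set.Icc (0 : ℝ) 1) := by
    have h0 : ContinuousOn (fun p : ℂ × ℝ => w + (p.2 : ℂ))
        (Metric.closedBall s 1 ×ˢ Set.Icc (0 : ℝ) 1) := by fun_prop
    have hsl : ∀ p ∈ Metric.closedBall s 1 ×ˢ Set.Icc (0 : ℝ) 1,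
        w + (p.2 : ℂ) ∈ Complex.slitPlane := fun p hp => add_mem_slitPlane hw hp.2.1
    have h1 : ContinuousOn (fun p : ℂ × ℝ => (w + (p.2 : ℂ)) ^ (-p.1))
        (Metric.closedBall s 1 ×ˢ Set.Icc (0 : ℝ) 1) := h0.cpow (by fun_prop) hsl
    have h2 : ContinuousOn (fun p : ℂ × ℝ => w ^ (-p.1))
        (Metric.closedBall s 1 ×ˢ Set.Icc (0 : ℝ) 1) :=
      ContinuousOn.const_cpow (by fun_prop) (Or.inl hw0)
    exact (h2.mul continuousOn_const).neg.sub (h1.mul (h0.clog hsl)).neg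
  obtain ⟨C, hC⟩ := ((isCompact_closedBall s 1).prod isCompact_Icc).exists_bound_of_continuousOn hF'
  have huI : Set.uIoc (0 : ℝ) 1 ⊆ Set.Icc 0 1 := by
    rw [Set.uIoc_of_le zero_le_one]
    exact Set.Ioc_subset_Icc_self
  have hint : ∀ x : ℂ, IntervalIntegrable (fun t : ℝ => w ^ (-x) - (w + (t : ℂ)) ^ (-x))
      volume 0 1 := fun x =>
    (continuousOn_const.sub (continuousOn_add_cpow hw (-x))).intervalIntegrable
  have := intervalIntegral.hasDerivAt_integral_of_dominated_loc_of_deriv_le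
    (μ := volume) (a := 0) (b := 1) (bound := fun _ => C)
    (F := fun (x : ℂ) (t : ℝ) => w ^ (-x) - (w + (t : ℂ)) ^ (-x)) (F' := F')
    (Metric.closedBall_mem_nhds s one_pos)
    (Filter.Eventually.of_forall fun x => (hint x).aestronglyMeasurable_restrict_uIoc)
    (hint s) ?_ ?_ (by simp) ?_
  · exact this.2.differentiableAt
  · refine ContinuousOn.aestronglyMeasurable ?_ measurableSet_uIoc
    exact hF'.comp (f := fun t : ℝ => (s, t)) (by fun_prop)
      (fun t ht => ⟨Metric.mem_closedBall_self zero_le_one, huI ht⟩)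
  · exact Filter.Eventually.of_forall fun t ht x hx => hC (x, t) ⟨hx, huI ht⟩
  · refine Filter.Eventually.of_forall fun t ht x _ => ?_
    have h1 : ∀ c : ℂ, c ≠ 0 →
        HasDerivAt (fun x : ℂ => c ^ (-x)) (-(c ^ (-x) * Complex.log c)) x := by
      intro c hc
      simpa using (hasDerivAt_id x).neg.const_cpow (c := c) (Or.inl hc)
    exact (h1 w hw0).sub (h1 _ (hne t (huI ht)))

/-- `hurwitzReg a` is holomorphic on `0 < re s`. -/
theorem differentiableAt_hurwitzReg {a : ℂ} (ha : 0 < a.re) {s : ℂ} (hs : 0 < s.re) :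
    DifferentiableAt ℂ (hurwitzReg a) s := by
  set U : Set ℂ := {z : ℂ | s.re / 2 < z.re} ∩ Metric.ball s 1 with hU
  have hUo : IsOpen U := (isOpen_lt continuous_const Complex.continuous_re).inter Metric.isOpen_ball
  have hsU : s ∈ U := ⟨by show s.re / 2 < s.re; linarith, Metric.mem_ball_self one_pos⟩
  set B : ℝ := Real.exp (Real.pi * (‖s‖ + 1)) with hB
  obtain ⟨K, hK0, hK⟩ : ∃ K : ℝ, 0 ≤ K ∧ ∀ z ∈ U, ∀ n : ℕ,
      ‖(n : ℂ) + a‖ ^ (-z.re - 1) ≤ K * ‖(n : ℂ) + a‖ ^ (-(s.re / 2 + 1)) := by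
    have ha' : 0 < ‖a‖ := norm_pos_iff.2 (fun h => by simp [h] at ha)
    have hA : 0 < min ‖a‖ 1 := lt_min ha' one_pos
    refine ⟨(min ‖a‖ 1) ^ (-(s.re / 2 + 1)), by positivity, fun z hz n => ?_⟩
    have hx : min ‖a‖ 1 ≤ ‖(n : ℂ) + a‖ := by
      refine (min_le_left _ _).trans ?_
      have := norm_le_norm_add ha (t := n) (Nat.cast_nonneg n)
      rwa [Complex.ofReal_natCast, add_comm] at this
    have hx0 : 0 < ‖(n : ℂ) + a‖ := hA.trans_le hx
    have hz1 : s.re / 2 < z.re := hz.1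
    have hz2 : z.re ≤ s.re + 1 := by
      have h1 := hz.2
      rw [mem_ball_iff_norm] at h1
      have h2 := Complex.re_le_norm (z - s)
      rw [Complex.sub_re] at h2
      linarith
    rw [show -z.re - 1 = -(z.re - s.re / 2) + -(s.re / 2 + 1) by ring, Real.rpow_add hx0]
    gcongr
    exact (Real.rpow_le_rpow_of_nonpos hA hx (by linarith)).trans
      (Real.rpow_le_rpow_of_exponent_ge hA (min_le_right _ _) (by linarith))
  have := Complex.differentiableOn_tsum_of_summable_norm (F := fun n s => hurwitzTerm a s n)
    (u := fun n => (‖s‖ + 1) * (K * ‖(n : ℂ) + a‖ ^ (-(s.re / 2 + 1)) * B))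
    ((((summable_bound ha (by linarith)).mul_left K).mul_right B).mul_left _)
    (fun n z _ => (differentiableAt_hurwitzTerm ha z n).differentiableWithinAt) hUo
    (fun n z hz => ?_)
  · exact (this s hsU).differentiableAt (hUo.mem_nhds hsU)
  · have hz1 : ‖z‖ ≤ ‖s‖ + 1 := by
      have := hz.2
      rw [Metric.mem_ball, dist_eq_norm] at this
      have h2 := norm_sub_norm_le z s
      linarith
    have hz0 : 0 < z.re := by have : s.re / 2 < z.re := hz.1; linarith
    refine (norm_hurwitzTerm_le ha hz0 n).trans ?_
    gcongr
    · exact hK z hz n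
    · rw [hB]
      gcongr
      exact (Complex.abs_im_le_norm z).trans hz1

theorem differentiableAt_hurwitzZeta {a : ℂ} (ha : 0 < a.re) {s : ℂ} (hs : 0 < s.re)
    (hs1 : s ≠ 1) : DifferentiableAt ℂ (hurwitzZeta a) s := by
  have ha' : a ≠ 0 := fun h => by simp [h] at ha
  refine DifferentiableAt.add ?_ (differentiableAt_hurwitzReg ha hs)
  exact DifferentiableAt.div (DifferentiableAt.const_cpow (by fun_prop) (Or.inl ha'))
    (by fun_prop) (sub_ne_zero.2 hs1)

/-- The Laurent expansion of `ζ(s, a)` at `s = 1`. -/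
theorem hasSum_stieltjesGamma {a : ℂ} (ha : 0 < a.re) {s : ℂ} (hs : ‖s - 1‖ < 1 / 2)
    (hs1 : s ≠ 1) :
    HasSum (fun l : ℕ => (-1) ^ l / (l.factorial : ℂ) * stieltjesGamma l a * (s - 1) ^ l)
      (hurwitzZeta a s - 1 / (s - 1)) := by
  have ha' : a ≠ 0 := fun h => by simp [h] at ha
  let R : ℂ → ℂ := fun s => dslope (fun s : ℂ => a ^ (1 - s)) 1 s + hurwitzReg a s
  have hre : ∀ z ∈ Metric.closedBall (1 : ℂ) (1 / 2), 0 < z.re := by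
    intro z hz
    rw [mem_closedBall_iff_norm] at hz
    have := (Complex.abs_re_le_norm (z - 1)).trans hz
    rw [abs_le, Complex.sub_re, Complex.one_re] at this
    linarith
  have hcp : Differentiable ℂ (fun s : ℂ => a ^ (1 - s)) := fun s =>
    DifferentiableAt.const_cpow (by fun_prop) (Or.inl ha')
  have hR : DifferentiableOn ℂ R (Metric.closedBall (1 : ℂ) (1 / 2)) := by
    intro z hz
    refine DifferentiableWithinAt.add ?_
      (differentiableAt_hurwitzReg ha (hre z hz)).differentiableWithinAt
    have := (Complex.differentiableOn_dslope (s := Set.univ) (c := (1 : ℂ)) Filter.univ_mem).2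
      hcp.differentiableOn
    exact (this.differentiableAt Filter.univ_mem).differentiableWithinAt
  have hRz : ∀ z : ℂ, z ≠ 1 → hurwitzZeta a z = (z - 1)⁻¹ + R z := by
    intro z hz
    have hz' : z - 1 ≠ 0 := sub_ne_zero.2 hz
    simp only [R, hurwitzZeta, dslope_of_ne _ hz, slope_def_field, sub_self, Complex.cpow_zero]
    field_simp
    ring
  have hsum := hasSum_cauchyPowerSeries_integral (f := R) (c := 1) (R := 1 / 2) (w := s - 1)
    ((hR.continuousOn.mono Metric.sphere_subset_closedBall).circleIntegrable (by norm_num)) hs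
  have hcauchy := hR.circleIntegral_sub_inv_smul (w := s) (by rwa [mem_ball_iff_norm])
  have hpi : (2 * (Real.pi : ℂ) * Complex.I) ≠ 0 := by simp [Real.pi_ne_zero]
  rw [add_sub_cancel, hcauchy, smul_smul, inv_mul_cancel₀ hpi, one_smul] at hsum
  rw [hRz s hs1, one_div, add_sub_cancel_left]
  refine hsum.congr_fun (fun l => ?_)
  have hcont : ContinuousOn (fun z : ℂ => R z / (z - 1) ^ (l + 1)) (Metric.sphere 1 (1 / 2)) :=
    (hR.continuousOn.mono Metric.sphere_subset_closedBall).div (by fun_prop) (fun z hz => by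
      refine pow_ne_zero _ (fun h => ?_)
      rw [mem_sphere_iff_norm, h] at hz
      norm_num at hz)
  have hcont' : ContinuousOn (fun z : ℂ => (z - 1) ^ (-(l + 2 : ℤ))) (Metric.sphere 1 (1 / 2)) :=
    ContinuousOn.zpow₀ (by fun_prop) _ (fun z hz => by
      left
      intro h
      rw [mem_sphere_iff_norm, h] at hz
      norm_num at hz)
  have hI : (∮ z in C(1, 1 / 2), hurwitzZeta a z / (z - 1) ^ (l + 1)) =
      ∮ z in C(1, 1 / 2), R z / (z - 1) ^ (l + 1) := by
    have h1 : (∮ z in C(1, 1 / 2), hurwitzZeta a z / (z - 1) ^ (l + 1)) =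
        ∮ z in C(1, 1 / 2), ((z - 1) ^ (-(l + 2 : ℤ)) + R z / (z - 1) ^ (l + 1)) := by
      refine circleIntegral.integral_congr (by norm_num) (fun z hz => ?_)
      have hz1 : z - 1 ≠ 0 := fun h => by
        rw [mem_sphere_iff_norm, h] at hz
        norm_num at hz
      have hz2 : (z - 1) ^ (-(l + 2 : ℤ)) = ((z - 1) ^ (l + 2))⁻¹ := by
        rw [zpow_neg]
        norm_cast
      simp only [hz2, hRz z (sub_ne_zero.1 hz1)]
      field_simp
      ring
    rw [h1, circleIntegral.integral_add (hcont'.circleIntegrable (by norm_num))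
      (hcont.circleIntegrable (by norm_num)), circleIntegral.integral_sub_zpow_of_ne (by lia),
      zero_add]
  have hJ : (∮ z in C(1, 1 / 2), ((s - 1) / (z - 1)) ^ l • (z - 1)⁻¹ • R z) =
      (s - 1) ^ l * ∮ z in C(1, 1 / 2), R z / (z - 1) ^ (l + 1) := by
    rw [← circleIntegral.integral_const_mul]
    congr 1
    ext z
    simp only [smul_eq_mul]
    rw [div_pow, div_eq_mul_inv, div_eq_mul_inv, pow_succ, mul_inv]
    ring
  have hfac : (l.factorial : ℂ) ≠ 0 := by exact_mod_cast l.factorial_ne_zero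
  have hsgn : ((-1 : ℂ) ^ l) * (-1) ^ l = 1 := by rw [← mul_pow]; simp
  rw [cauchyPowerSeries_apply, hJ, stieltjesGamma, hI, smul_eq_mul]
  generalize (∮ z in C(1, 1 / 2), R z / (z - 1) ^ (l + 1)) = J
  calc _ = ((-1 : ℂ) ^ l * (-1) ^ l) * ((l.factorial : ℂ) / l.factorial) *
        ((2 * (Real.pi : ℂ) * Complex.I)⁻¹ * J) * (s - 1) ^ l := by ring
    _ = _ := by rw [hsgn, div_self hfac]; ring

end HurwitzStieltjes

end

namespace HurwitzStieltjes

/-! Put u = λ/(λ+1), so that u - 1 = -1/(λ+1), and let c(m,j) = |s(j,m)|/j! be the coefficients of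
(-log(1-x))^m/m!. Up to the sign (-1)^k, the j-th summand of S_k is c(k+1,j) (u^j - (u-1)^j)
ζ^{(ℓ-k)}(j,a). Expanding the zeta derivative over w = n + a and summing over j first gives, for
each w, a difference of powers of log w - log(w-u) and log w - log(w+1-u), minus the missing j = 1
term (`logBracket`).

Weighted by ℓ!/(ℓ-k)! and summed over k, the binomial theorem turns these brackets into T(n) -
T(n+1) - (-log w)^ℓ/w with T(n) = (-log(n+a-u))^{ℓ+1}/(ℓ+1) (`sum_lambdaSeriesTerm`). The sum over n
telescopes, and what remains is the limit formula for γ_ℓ(a) (`tendsto_stieltjesGamma`), whence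
`stieltjesGamma_eq_lambdaSeries`.

The bracket is O(|w|^{-2}) locally uniformly in u, so the sum over n is holomorphic in |u| < |a|;
this is the continuation of S_k. It agrees with the Stirling series by Fubini when |u-1| < |a|
(`hasSum_stirlingTerm`). When |u-1| = |a| only n = 0 lies on the boundary of convergence, and there
summation by parts suffices (`tendsto_sum_logPowCoeff`, `tendsto_sum_stirlingTerm`).

For λ = i, half the sum and the difference of the formulas at λ = i and λ = -i give the two
identities. -/

/-! ### Growth of log(n + a) and summability -/

theorem nat_add_ne_zero {a : ℂ} (ha : 0 < a.re) (n : ℕ) : (n : ℂ) + a ≠ 0 := fun h => by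
  have := nat_add_re_pos ha n
  simp [h] at this

theorem tendsto_norm_nat_add {a : ℂ} (ha : 0 < a.re) :
    Tendsto (fun n : ℕ => ‖(n : ℂ) + a‖) atTop atTop := by
  refine tendsto_atTop_mono (fun n => ?_) (tendsto_natCast_atTop_atTop (R := ℝ))
  have := Complex.re_le_norm ((n : ℂ) + a)
  simp only [Complex.add_re, Complex.natCast_re] at this
  linarith

theorem isBigO_log_nat_add {a : ℂ} (ha : 0 < a.re) {ε : ℝ} (hε : 0 < ε) :
    (fun n : ℕ => Complex.log ((n : ℂ) + a)) =O[atTop] fun n : ℕ => ‖(n : ℂ) + a‖ ^ ε := by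
  have h1 : (fun x : ℝ => Real.log x + Real.pi) =O[atTop] fun x : ℝ => x ^ ε := by
    refine (isLittleO_log_rpow_atTop hε).isBigO.add ?_
    exact (Asymptotics.isLittleO_const_left.2
      (Or.inr (tendsto_norm_atTop_atTop.comp (tendsto_rpow_atTop hε)))).isBigO
  refine Asymptotics.IsBigO.trans ?_ (h1.comp_tendsto (tendsto_norm_nat_add ha))
  refine Asymptotics.IsBigO.of_bound 1 ?_
  filter_upwards [(tendsto_norm_nat_add ha).eventually_ge_atTop 1] with n hn
  have h2 : 0 ≤ Real.log ‖(n : ℂ) + a‖ := Real.log_nonneg hn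
  rw [one_mul]
  refine (Complex.norm_le_abs_re_add_abs_im _).trans ?_
  rw [Complex.log_re, Complex.log_im, abs_of_nonneg h2]
  refine le_trans ?_ (Real.le_norm_self _)
  exact add_le_add_right (Complex.abs_arg_le_pi _) _

theorem isBigO_log_pow_nat_add {a : ℂ} (ha : 0 < a.re) (r : ℕ) {ε : ℝ} (hε : 0 < ε) :
    (fun n : ℕ => Complex.log ((n : ℂ) + a) ^ r) =O[atTop] fun n : ℕ => ‖(n : ℂ) + a‖ ^ ε := by
  rcases Nat.eq_zero_or_pos r with rfl | hr
  · simp only [pow_zero]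
    exact (Asymptotics.isLittleO_const_left.2 (Or.inr (tendsto_norm_atTop_atTop.comp
      ((tendsto_rpow_atTop hε).comp (tendsto_norm_nat_add ha))))).isBigO
  · have hr' : (r : ℝ) ≠ 0 := by positivity
    -- The exponent ε/r becomes ε after taking the r-th power.
    refine ((isBigO_log_nat_add ha (div_pos hε (by positivity : (0 : ℝ) < r))).pow r).congr_right ?_
    intro n
    rw [← Real.rpow_natCast, ← Real.rpow_mul (norm_nonneg _), div_mul_cancel₀ _ hr']

/-- Half of the excess c - 1 absorbs the logarithms; the exponent (1 + c)/2 that remains still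
exceeds 1. -/
theorem summable_log_pow_mul {a : ℂ} (ha : 0 < a.re) (r : ℕ) {c : ℝ} (hc : 1 < c) :
    Summable fun n : ℕ => ‖Complex.log ((n : ℂ) + a)‖ ^ r * ‖(n : ℂ) + a‖ ^ (-c) := by
  refine summable_of_isBigO_nat (summable_bound ha (c := (1 + c) / 2) (by linarith)) ?_
  have h := ((isBigO_log_pow_nat_add ha r (ε := (c - 1) / 2) (by linarith)).norm_left).mul
    (Asymptotics.isBigO_refl (fun n : ℕ => ‖(n : ℂ) + a‖ ^ (-c)) atTop)
  refine (h.congr_left fun n => by rw [norm_pow]).congr_right fun n => ?_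
  rw [← Real.rpow_add (norm_pos_iff.2 (nat_add_ne_zero ha n))]
  ring_nf

theorem tendsto_log_pow_div {a : ℂ} (ha : 0 < a.re) (r : ℕ) :
    Tendsto (fun n : ℕ => ‖Complex.log ((n : ℂ) + a)‖ ^ r / ‖(n : ℂ) + a‖) atTop (𝓝 0) := by
  have h := ((isBigO_log_pow_nat_add ha r (ε := 1 / 2) (by norm_num)).norm_left).mul
    (Asymptotics.isBigO_refl (fun n : ℕ => ‖(n : ℂ) + a‖⁻¹) atTop)
  refine (h.congr_left fun n => by rw [norm_pow, div_eq_mul_inv]).trans_tendsto ?_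
  refine ((tendsto_rpow_neg_atTop (y := 1 / 2) (by norm_num)).comp
    (tendsto_norm_nat_add ha)).congr fun n => ?_
  have h0 := norm_pos_iff.2 (nat_add_ne_zero ha n)
  simp only [Function.comp]
  rw [← Real.rpow_neg_one, ← Real.rpow_add h0]
  norm_num

theorem norm_nat_add_cpow_le {a : ℂ} (ha : 0 < a.re) (n : ℕ) (z : ℂ) :
    ‖((n : ℂ) + a) ^ z‖ ≤ ‖(n : ℂ) + a‖ ^ z.re * Real.exp (Real.pi * |z.im|) := by
  rw [Complex.norm_cpow_of_ne_zero (nat_add_ne_zero ha n), div_eq_mul_inv, ← Real.exp_neg]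
  gcongr
  have h1 := Complex.abs_arg_le_pi ((n : ℂ) + a)
  calc -(((n : ℂ) + a).arg * z.im) ≤ |((n : ℂ) + a).arg * z.im| := neg_le_abs _
    _ ≤ Real.pi * |z.im| := by rw [abs_mul]; gcongr

theorem norm_le_norm_nat_add {a : ℂ} (ha : 0 < a.re) (n : ℕ) : ‖a‖ ≤ ‖(n : ℂ) + a‖ := by
  have := norm_le_norm_add ha (t := n) (Nat.cast_nonneg n)
  rwa [Complex.ofReal_natCast, add_comm] at this

/-! ### Derivatives of the Hurwitz series -/

/-- The termwise `r`-th derivative of the Hurwitz series. -/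
theorem hasSum_iteratedDeriv_hurwitzZeta {a : ℂ} (ha : 0 < a.re) (r : ℕ) :
    ∀ s : ℂ, 1 < s.re →
      HasSum (fun n : ℕ => (-Complex.log ((n : ℂ) + a)) ^ r * ((n : ℂ) + a) ^ (-s))
        (iteratedDeriv r (hurwitzZeta a) s) := by
  induction r with
  | zero =>
    intro s hs
    refine (hasSum_hurwitzZeta ha hs).congr_fun fun n => ?_
    rw [pow_zero, one_mul, Complex.cpow_neg, one_div]
  | succ r ih =>
    intro s hs
    set c : ℝ := (1 + s.re) / 2 with hc
    set U : Set ℂ := {z : ℂ | c < z.re} ∩ Metric.ball s 1 with hU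
    have hUo : IsOpen U :=
      (isOpen_lt continuous_const Complex.continuous_re).inter Metric.isOpen_ball
    have hsU : s ∈ U := ⟨by show c < s.re; linarith, Metric.mem_ball_self one_pos⟩
    have ha' : 0 < ‖a‖ := norm_pos_iff.2 (fun h => by simp [h] at ha)
    -- A lower bound for all |n + a| that is at most 1: its negative powers grow with the size of
    -- the exponent, so one constant serves every z in `U`, even if |a| < 1.
    have hA : 0 < min ‖a‖ 1 := lt_min ha' one_pos
    let F : ℕ → ℂ → ℂ := fun n z => (-Complex.log ((n : ℂ) + a)) ^ r * ((n : ℂ) + a) ^ (-z)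
    have hder : ∀ n z, HasDerivAt (F n)
        ((-Complex.log ((n : ℂ) + a)) ^ (r + 1) * ((n : ℂ) + a) ^ (-z)) z := by
      intro n z
      have h := ((hasDerivAt_id z).neg.const_cpow (c := (n : ℂ) + a)
        (Or.inl (nat_add_ne_zero ha n))).const_mul ((-Complex.log ((n : ℂ) + a)) ^ r)
      convert! h using 1
      simp only [id, Pi.neg_apply]
      ring
    have hbound : ∀ n, ∀ z ∈ U, ‖F n z‖ ≤
        ‖Complex.log ((n : ℂ) + a)‖ ^ r * ‖(n : ℂ) + a‖ ^ (-c) *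
          ((min ‖a‖ 1) ^ (-(s.re + 1)) * Real.exp (Real.pi * (‖s‖ + 1))) := by
      intro n z hz
      have hz1 : c < z.re := hz.1
      have hzs : ‖z - s‖ < 1 := mem_ball_iff_norm.1 hz.2
      have hz2 : z.re ≤ s.re + 1 := by
        have := Complex.re_le_norm (z - s)
        rw [Complex.sub_re] at this
        linarith
      have hz3 : |z.im| ≤ ‖s‖ + 1 := by
        have h1 := Complex.abs_im_le_norm z
        have h2 := norm_sub_norm_le z s
        linarith
      have hx : min ‖a‖ 1 ≤ ‖(n : ℂ) + a‖ := (min_le_left _ _).trans (norm_le_norm_nat_add ha n)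
      have hx0 : 0 < ‖(n : ℂ) + a‖ := hA.trans_le hx
      have h1 : ‖(n : ℂ) + a‖ ^ (-z.re) ≤ ‖(n : ℂ) + a‖ ^ (-c) * (min ‖a‖ 1) ^ (-(s.re + 1)) := by
        rw [show -z.re = -c + -(z.re - c) by ring, Real.rpow_add hx0]
        gcongr
        exact (Real.rpow_le_rpow_of_nonpos hA hx (by linarith)).trans
          (Real.rpow_le_rpow_of_exponent_ge hA (min_le_right _ _) (by linarith))
      rw [norm_mul, norm_pow, norm_neg]
      have h2 := norm_nat_add_cpow_le ha n (-z)
      rw [Complex.neg_re, Complex.neg_im, abs_neg] at h2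
      calc _ ≤ ‖Complex.log ((n : ℂ) + a)‖ ^ r * (‖(n : ℂ) + a‖ ^ (-c) *
            (min ‖a‖ 1) ^ (-(s.re + 1)) * Real.exp (Real.pi * (‖s‖ + 1))) := by
            gcongr
            refine h2.trans ?_
            gcongr
        _ = _ := by ring
    have h := Complex.hasSum_deriv_of_summable_norm
      ((summable_log_pow_mul ha r (c := c) (by linarith)).mul_right _)
      (fun n z _ => (hder n z).differentiableAt.differentiableWithinAt) hUo hbound hsU
    have heq : (fun z => ∑' n, F n z) =ᶠ[𝓝 s] iteratedDeriv r (hurwitzZeta a) := by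
      filter_upwards [hUo.mem_nhds hsU] with z hz
      have hz1 : c < z.re := hz.1
      exact (ih z (by linarith)).tsum_eq
    rw [heq.deriv_eq, ← iteratedDeriv_succ] at h
    exact h.congr_fun fun n => (hder n s).deriv.symm

theorem hasSum_hurwitzZetaDeriv {a : ℂ} (ha : 0 < a.re) (r : ℕ) {j : ℕ} (hj : 2 ≤ j) :
    HasSum (fun n : ℕ => (-Complex.log ((n : ℂ) + a)) ^ r / ((n : ℂ) + a) ^ j)
      (hurwitzZetaDeriv r j a) := by
  have hj' : 1 < ((j : ℂ)).re := by
    rw [Complex.natCast_re]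
    exact_mod_cast hj
  refine (hasSum_iteratedDeriv_hurwitzZeta ha r j hj').congr_fun fun n => ?_
  rw [Complex.cpow_neg, Complex.cpow_natCast, div_eq_mul_inv]

/-- Splitting off the first term of the Hurwitz series. -/
theorem hurwitzZetaDeriv_eq_add {a : ℂ} (ha : 0 < a.re) (r : ℕ) {j : ℕ} (hj : 2 ≤ j) :
    hurwitzZetaDeriv r j a = (-Complex.log a) ^ r / a ^ j + hurwitzZetaDeriv r j (a + 1) := by
  have h1 := (hasSum_nat_add_iff' 1).2 (hasSum_hurwitzZetaDeriv ha r hj)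
  have ha1 : 0 < (a + 1).re := by
    rw [Complex.add_re, Complex.one_re]
    linarith
  have h2 := h1.unique ((hasSum_hurwitzZetaDeriv ha1 r hj).congr_fun fun n => by
    rw [show ((n + 1 : ℕ) : ℂ) + a = (n : ℂ) + (a + 1) by push_cast; ring])
  simp only [Finset.sum_range_one, Nat.cast_zero, zero_add] at h2
  rw [← h2]
  ring

/-! ### Size and variation of the Stirling coefficients -/

/-- The coefficients of `(-log (1 - x)) ^ m / m!`. -/
noncomputable def logPowCoeff (m j : ℕ) : ℝ := (Nat.stirlingFirst j m : ℝ) / (j.factorial : ℝ)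

theorem logPowCoeff_nonneg (m j : ℕ) : 0 ≤ logPowCoeff m j := by
  unfold logPowCoeff
  positivity

theorem stirlingFirst_le_factorial (j m : ℕ) : Nat.stirlingFirst j m ≤ j.factorial := by
  induction j generalizing m with
  | zero => cases m <;> simp
  | succ j ih =>
    cases m with
    | zero => simp
    | succ m =>
      rw [Nat.stirlingFirst_succ_succ, Nat.factorial_succ, add_mul, one_mul]
      exact add_le_add (Nat.mul_le_mul_left _ (ih _)) (ih _)

theorem logPowCoeff_le_one (m j : ℕ) : logPowCoeff m j ≤ 1 := by
  rw [logPowCoeff, div_le_one (by positivity)]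
  exact_mod_cast stirlingFirst_le_factorial j m

theorem norm_logPowCoeff_le_one (m j : ℕ) : ‖(logPowCoeff m j : ℂ)‖ ≤ 1 := by
  rw [Complex.norm_real, Real.norm_of_nonneg (logPowCoeff_nonneg m j)]
  exact logPowCoeff_le_one m j

/-- The Stirling recurrence divided by j!. On generating functions it reads (1 - x) f_{m+1}' = f_m.
-/
theorem logPowCoeff_succ (m j : ℕ) :
    ((j : ℝ) + 1) * logPowCoeff (m + 1) (j + 1) =
      j * logPowCoeff (m + 1) j + logPowCoeff m j := by
  have h : (j.factorial : ℝ) ≠ 0 := by positivity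
  have h' : (j : ℝ) + 1 ≠ 0 := by positivity
  rw [logPowCoeff, logPowCoeff, logPowCoeff, Nat.stirlingFirst_succ_succ, Nat.factorial_succ]
  push_cast
  field_simp

theorem logPowCoeff_succ_zero (m : ℕ) : logPowCoeff (m + 1) 0 = 0 := by
  simp [logPowCoeff]

theorem logPowCoeff_zero_left (j : ℕ) : logPowCoeff 0 j = if j = 0 then 1 else 0 := by
  cases j <;> simp [logPowCoeff]

/-- By the recurrence, j c(m+1,j) is the sum of the c(m,i) with i < j, and the partial sums of
i^{-1/2} are O(√j). So the bound O(j^{-1/2}) reproduces itself in m; it is cruder than the true size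
but sufficient. -/
theorem exists_logPowCoeff_le (m : ℕ) :
    ∃ C : ℝ, 0 ≤ C ∧ ∀ j : ℕ, (j : ℝ) * logPowCoeff m j ≤ C * Real.sqrt j := by
  induction m with
  | zero =>
    refine ⟨0, le_rfl, fun j => ?_⟩
    rw [logPowCoeff_zero_left]
    split_ifs with h <;> simp [h]
  | succ m ih =>
    obtain ⟨C, hC, h⟩ := ih
    -- The part 3C pays for the increments, since 1/√j ≤ 3(√(j+1) - √j) for j ≥ 1; the 1 pays for
    -- the step from 0 to 1.
    refine ⟨3 * C + 1, by positivity, fun j => ?_⟩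
    induction j with
    | zero => simp
    | succ j ihj =>
      have h1 := logPowCoeff_succ m j
      push_cast
      rw [h1]
      rcases Nat.eq_zero_or_pos j with rfl | hj
      · have := logPowCoeff_le_one m 0
        simp only [Nat.cast_zero, zero_mul, zero_add, Real.sqrt_one, mul_one]
        linarith
      · have hj' : (1 : ℝ) ≤ j := by exact_mod_cast hj
        set x := Real.sqrt j with hx
        set y := Real.sqrt ((j : ℝ) + 1) with hy
        have hx2 : x * x = j := Real.mul_self_sqrt (by positivity)
        have hy2 : y * y = j + 1 := Real.mul_self_sqrt (by positivity)
        have hx0 : 1 ≤ x := by rw [hx]; exact Real.one_le_sqrt.2 hj'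
        have hy0 : 0 ≤ y := Real.sqrt_nonneg _
        have h2 : x * x * logPowCoeff m j ≤ C * x := by
          rw [hx2]
          exact h j
        have hyx : y ≤ 2 * x := by nlinarith
        have h3 : logPowCoeff m j * x ≤ C := by
          have : x * (logPowCoeff m j * x) ≤ x * C := by linarith
          exact le_of_mul_le_mul_left this (by linarith)
        have h4 : 1 ≤ 3 * (x * (y - x)) := by nlinarith
        have h5 : logPowCoeff m j ≤ 3 * C * (y - x) := by
          have hyx' : 0 ≤ y - x := by nlinarith
          have h6 := logPowCoeff_nonneg m j
          calc logPowCoeff m j ≤ logPowCoeff m j * (3 * (x * (y - x))) :=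
                le_mul_of_one_le_right h6 h4
            _ = 3 * (logPowCoeff m j * x) * (y - x) := by ring
            _ ≤ 3 * C * (y - x) := by gcongr
        nlinarith

theorem tendsto_logPowCoeff (m : ℕ) : Tendsto (logPowCoeff m) atTop (𝓝 0) := by
  obtain ⟨C, hC, h⟩ := exists_logPowCoeff_le m
  have h1 : Tendsto (fun j : ℕ => C / Real.sqrt j) atTop (𝓝 0) :=
    (Real.tendsto_sqrt_atTop.comp tendsto_natCast_atTop_atTop).const_div_atTop C
  refine squeeze_zero' (Eventually.of_forall fun j => logPowCoeff_nonneg m j) ?_ h1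
  filter_upwards [eventually_gt_atTop 0] with j hj
  have hj' : (0 : ℝ) < Real.sqrt j := Real.sqrt_pos.2 (by exact_mod_cast hj)
  rw [le_div_iff₀ hj']
  have h2 := h j
  rw [← Real.mul_self_sqrt (Nat.cast_nonneg (α := ℝ) j)] at h2
  have : Real.sqrt j * (logPowCoeff m j * Real.sqrt j) ≤ Real.sqrt j * C := by
    rw [Real.sqrt_mul_self hj'.le] at h2
    linarith
  exact le_of_mul_le_mul_left this hj'

/-- The recurrence gives c(m+1,i+1) - c(m+1,i) = (c(m,i) - c(m+1,i))/(i+1) = O(i^{-3/2}). This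
bounded variation is what makes summation by parts work on the unit circle. -/
theorem summable_logPowCoeff_sub (m : ℕ) :
    Summable fun j : ℕ => |logPowCoeff (m + 1) (j + 1) - logPowCoeff (m + 1) j| := by
  obtain ⟨C, hC, h⟩ := exists_logPowCoeff_le m
  obtain ⟨C', hC', h'⟩ := exists_logPowCoeff_le (m + 1)
  have hs : Summable fun j : ℕ => (C + C') * (1 / (j : ℝ) ^ (3 / 2 : ℝ)) :=
    (Real.summable_one_div_nat_rpow.2 (by norm_num)).mul_left _
  refine (summable_nat_add_iff 1).1
    (((summable_nat_add_iff 1).2 hs).of_nonneg_of_le (fun j => abs_nonneg _) fun j => ?_)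
  obtain ⟨i, hi⟩ : ∃ i, i = j + 1 := ⟨_, rfl⟩
  rw [← hi]
  have hi1 : (1 : ℝ) ≤ i := by rw [hi]; push_cast; linarith [Nat.cast_nonneg (α := ℝ) j]
  have hi0 : (0 : ℝ) < i := by linarith
  have e : logPowCoeff (m + 1) (i + 1) - logPowCoeff (m + 1) i =
      (logPowCoeff m i - logPowCoeff (m + 1) i) / (i + 1) := by
    have := logPowCoeff_succ m i
    field_simp
    linarith
  have h3 : (i : ℝ) * |logPowCoeff m i - logPowCoeff (m + 1) i| ≤ (C + C') * Real.sqrt i := by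
    have h1 := h i
    have h2 := h' i
    have h4 : |logPowCoeff m i - logPowCoeff (m + 1) i| ≤ logPowCoeff m i + logPowCoeff (m + 1) i := by
      have h5 := logPowCoeff_nonneg m i
      have h6 := logPowCoeff_nonneg (m + 1) i
      rw [abs_le]
      constructor <;> linarith
    nlinarith
  rw [e, abs_div, abs_of_pos (by positivity : (0 : ℝ) < i + 1), mul_one_div,
    div_le_div_iff₀ (by positivity) (by positivity)]
  have h5 : (i : ℝ) ^ (3 / 2 : ℝ) = i * Real.sqrt i := by
    rw [show (3 / 2 : ℝ) = 1 + 1 / 2 by norm_num, Real.rpow_add hi0, Real.rpow_one,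
      Real.sqrt_eq_rpow]
  have h6 := Real.mul_self_sqrt hi0.le
  rw [h5]
  calc _ = (i * |logPowCoeff m i - logPowCoeff (m + 1) i|) * Real.sqrt i := by ring
    _ ≤ ((C + C') * Real.sqrt i) * Real.sqrt i := by gcongr
    _ = (C + C') * i := by rw [mul_assoc, h6]
    _ ≤ _ := by gcongr; linarith

/-! ### Powers of the logarithm as power series, up to the unit circle -/

theorem summable_logPowCoeff_mul_pow (m : ℕ) {x : ℂ} (hx : ‖x‖ < 1) :
    Summable fun j : ℕ => (logPowCoeff m j : ℂ) * x ^ j := by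
  refine Summable.of_norm_bounded (summable_geometric_of_lt_one (norm_nonneg x) hx) fun j => ?_
  rw [norm_mul, norm_pow]
  exact mul_le_of_le_one_left (by positivity) (norm_logPowCoeff_le_one m j)

theorem one_sub_mem_slitPlane {x : ℂ} (hx : ‖x‖ ≤ 1) (hx1 : x ≠ 1) : 1 - x ∈ Complex.slitPlane := by
  rw [Complex.mem_slitPlane_iff]
  by_contra! h
  have h1 : x.re ≤ 1 := (Complex.re_le_norm x).trans hx
  simp only [Complex.sub_re, Complex.one_re, Complex.sub_im, Complex.one_im] at h
  refine hx1 (Complex.ext ?_ ?_)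
  · rw [Complex.one_re]
    linarith
  · rw [Complex.one_im]
    linarith

theorem hasDerivAt_tsum_logPowCoeff (m : ℕ) {x : ℂ} (hx : ‖x‖ < 1) :
    HasDerivAt (fun z : ℂ => ∑' j : ℕ, (logPowCoeff (m + 1) j : ℂ) * z ^ j)
      ((∑' j : ℕ, (logPowCoeff m j : ℂ) * x ^ j) / (1 - x)) x := by
  obtain ⟨ρ, hρ1, hρ2⟩ := exists_between hx
  have hρ0 : 0 ≤ ρ := (norm_nonneg x).trans hρ1.le
  have hbound : ∀ (j : ℕ), ∀ z ∈ Metric.ball (0 : ℂ) ρ,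
      ‖(logPowCoeff (m + 1) j : ℂ) * z ^ j‖ ≤ ρ ^ j := by
    intro j z hz
    rw [norm_mul, norm_pow]
    refine (mul_le_of_le_one_left (by positivity) (norm_logPowCoeff_le_one _ j)).trans ?_
    gcongr
    exact (mem_ball_zero_iff.1 hz).le
  have hxU : x ∈ Metric.ball (0 : ℂ) ρ := mem_ball_zero_iff.2 hρ1
  have hgeo := summable_geometric_of_lt_one hρ0 hρ2
  have hd := Complex.hasSum_deriv_of_summable_norm hgeo
    (F := fun (j : ℕ) (z : ℂ) => (logPowCoeff (m + 1) j : ℂ) * z ^ j)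
    (fun j => by fun_prop) Metric.isOpen_ball hbound hxU
  have hdiff := (Complex.differentiableOn_tsum_of_summable_norm hgeo
    (F := fun (j : ℕ) (z : ℂ) => (logPowCoeff (m + 1) j : ℂ) * z ^ j)
    (fun j => by fun_prop) Metric.isOpen_ball hbound).differentiableAt
      (Metric.isOpen_ball.mem_nhds hxU)
  set D := deriv (fun z : ℂ => ∑' j : ℕ, (logPowCoeff (m + 1) j : ℂ) * z ^ j) x with hD
  have h0 : HasSum (fun j : ℕ => (j : ℂ) * (logPowCoeff (m + 1) j : ℂ) * x ^ (j - 1)) D := by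
    refine hd.congr_fun fun j => ?_
    have := ((hasDerivAt_pow j x).const_mul (logPowCoeff (m + 1) j : ℂ)).deriv
    rw [this]
    ring
  have h1 : HasSum (fun j : ℕ => ((j : ℂ) + 1) * (logPowCoeff (m + 1) (j + 1) : ℂ) * x ^ j) D := by
    have := (hasSum_nat_add_iff' 1).2 h0
    simpa using this
  have h2 : HasSum (fun j : ℕ => (j : ℂ) * (logPowCoeff (m + 1) j : ℂ) * x ^ j) (x * D) := by
    refine (h0.mul_left x).congr_fun fun j => ?_
    rcases Nat.eq_zero_or_pos j with rfl | hj
    · simp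
    · obtain ⟨i, rfl⟩ := Nat.exists_eq_add_of_lt hj
      simp only [zero_add, Nat.add_sub_cancel]
      ring
  -- The coefficients of D - xD are exactly those of the series for m, by the recurrence.
  have h3 := (h1.sub h2).unique ((summable_logPowCoeff_mul_pow m hx).hasSum.congr_fun fun j => by
    have := congrArg (fun t : ℝ => (t : ℂ)) (logPowCoeff_succ m j)
    simp only [Complex.ofReal_mul, Complex.ofReal_add, Complex.ofReal_natCast,
      Complex.ofReal_one] at this
    rw [this]
    ring)
  have hx1 : 1 - x ≠ 0 := sub_ne_zero.2 fun h => by simp [← h] at hx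
  have h4 : D = (∑' j : ℕ, (logPowCoeff m j : ℂ) * x ^ j) / (1 - x) := by
    rw [eq_div_iff hx1, ← h3]
    ring
  rw [← h4]
  exact hdiff.hasDerivAt

/-- The exponential generating function of the Stirling numbers of the first kind. -/
theorem tsum_logPowCoeff (m : ℕ) : ∀ x : ℂ, ‖x‖ < 1 →
    ∑' j : ℕ, (logPowCoeff m j : ℂ) * x ^ j = (-Complex.log (1 - x)) ^ m / (m.factorial : ℂ) := by
  induction m with
  | zero =>
    intro x _
    rw [tsum_eq_single 0 fun j hj => by simp [logPowCoeff_zero_left, hj]]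
    simp [logPowCoeff_zero_left]
  | succ m ih =>
    intro x hx
    -- The difference of the two sides has derivative 0 on the disc by the induction hypothesis, and
    -- it vanishes at 0.
    set G : ℂ → ℂ := fun z => (∑' j : ℕ, (logPowCoeff (m + 1) j : ℂ) * z ^ j) -
      (-Complex.log (1 - z)) ^ (m + 1) / ((m + 1).factorial : ℂ) with hG
    have hder : ∀ z ∈ Metric.ball (0 : ℂ) 1, HasDerivAt G 0 z := by
      intro z hz
      have hz' := mem_ball_zero_iff.1 hz
      have hz1 : z ≠ 1 := fun h => by simp [h] at hz'
      have h1 := hasDerivAt_tsum_logPowCoeff m hz'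
      have h2 := ((((hasDerivAt_id z).const_sub 1).clog
        (one_sub_mem_slitPlane hz'.le hz1)).neg.pow (m + 1)).div_const ((m + 1).factorial : ℂ)
      convert! h1.sub h2 using 1
      rw [ih z hz', Nat.factorial_succ]
      have hm : (m.factorial : ℂ) ≠ 0 := by exact_mod_cast m.factorial_ne_zero
      have hm' : (m : ℂ) + 1 ≠ 0 := by exact_mod_cast m.succ_ne_zero
      have hz2 : 1 - z ≠ 0 := sub_ne_zero.2 hz1.symm
      simp only [id, Nat.add_sub_cancel, Pi.neg_apply]
      push_cast
      field_simp
      ring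
    have h := (convex_ball (0 : ℂ) 1).is_const_of_fderivWithin_eq_zero (𝕜 := ℂ) (f := G)
      (fun z hz => (hder z hz).differentiableAt.differentiableWithinAt)
      (fun z hz => by
        rw [fderivWithin_of_isOpen Metric.isOpen_ball hz]
        ext
        simp [(hder z hz).deriv])
      (mem_ball_zero_iff.2 hx) (Metric.mem_ball_self one_pos)
    have h0 : G 0 = 0 := by
      have : ∑' j : ℕ, (logPowCoeff (m + 1) j : ℂ) * 0 ^ j = 0 := by
        rw [← tsum_zero (α := ℂ) (β := ℕ)]
        congr 1
        ext j
        rcases Nat.eq_zero_or_pos j with rfl | hj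
        · simp [logPowCoeff_succ_zero]
        · simp [hj.ne']
      simp [hG, this]
    rw [h0] at h
    exact sub_eq_zero.1 h

theorem hasSum_logPowCoeff (m : ℕ) {x : ℂ} (hx : ‖x‖ < 1) :
    HasSum (fun j : ℕ => (logPowCoeff m j : ℂ) * x ^ j)
      ((-Complex.log (1 - x)) ^ m / (m.factorial : ℂ)) := by
  rw [← tsum_logPowCoeff m x hx]
  exact (summable_logPowCoeff_mul_pow m hx).hasSum

/-- Summation by parts; there is no lower boundary term because the coefficient of index 0 vanishes.
-/
theorem one_sub_mul_sum_logPowCoeff (m N : ℕ) (x : ℂ) :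
    (1 - x) * ∑ j ∈ Finset.range N, (logPowCoeff (m + 1) j : ℂ) * x ^ j =
      x * ∑ j ∈ Finset.range N,
        ((logPowCoeff (m + 1) (j + 1) - logPowCoeff (m + 1) j : ℝ) : ℂ) * x ^ j -
        (logPowCoeff (m + 1) N : ℂ) * x ^ N := by
  induction N with
  | zero => simp [logPowCoeff_succ_zero]
  | succ N ih =>
    rw [Finset.sum_range_succ, Finset.sum_range_succ, mul_add, ih]
    push_cast
    ring

/-- On the closed disc without `1` the partial sums of the series of `(-log (1 - x)) ^ m / m!`
converge. -/
theorem tendsto_sum_logPowCoeff (m : ℕ) {x : ℂ} (hx : ‖x‖ ≤ 1) (hx1 : x ≠ 1) :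
    Tendsto (fun N : ℕ => ∑ j ∈ Finset.range N, (logPowCoeff (m + 1) j : ℂ) * x ^ j) atTop
      (𝓝 ((-Complex.log (1 - x)) ^ (m + 1) / ((m + 1).factorial : ℂ))) := by
  let e : ℕ → ℂ := fun j => ((logPowCoeff (m + 1) (j + 1) - logPowCoeff (m + 1) j : ℝ) : ℂ)
  have hbound : ∀ (j : ℕ), ∀ z ∈ Metric.closedBall (0 : ℂ) 1,
      ‖e j * z ^ j‖ ≤ |logPowCoeff (m + 1) (j + 1) - logPowCoeff (m + 1) j| := by
    intro j z hz
    rw [norm_mul, norm_pow, Complex.norm_real, Real.norm_eq_abs]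
    exact mul_le_of_le_one_right (abs_nonneg _)
      (pow_le_one₀ (norm_nonneg _) (mem_closedBall_zero_iff.1 hz))
  -- Summable variation makes the series of differences continuous up to the circle, so its value at
  -- a boundary point can be read off from inside.
  have hcont : ContinuousOn (fun z : ℂ => ∑' j, e j * z ^ j) (Metric.closedBall (0 : ℂ) 1) :=
    continuousOn_tsum (fun j => by fun_prop) (summable_logPowCoeff_sub m) hbound
  have hlim : ∀ z : ℂ, ‖z‖ ≤ 1 → z ≠ 1 →
      Tendsto (fun N : ℕ => ∑ j ∈ Finset.range N, (logPowCoeff (m + 1) j : ℂ) * z ^ j) atTop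
        (𝓝 ((z * ∑' j, e j * z ^ j) / (1 - z))) := by
    intro z hz hz1
    have hs : Summable fun j => e j * z ^ j :=
      Summable.of_norm_bounded (summable_logPowCoeff_sub m)
        fun j => hbound j z (mem_closedBall_zero_iff.2 hz)
    have h0 : Tendsto (fun N : ℕ => (logPowCoeff (m + 1) N : ℂ) * z ^ N) atTop (𝓝 0) := by
      refine squeeze_zero_norm (fun N => ?_) (tendsto_logPowCoeff (m + 1))
      rw [norm_mul, norm_pow, Complex.norm_real, Real.norm_of_nonneg (logPowCoeff_nonneg _ _)]
      exact mul_le_of_le_one_right (logPowCoeff_nonneg _ _) (pow_le_one₀ (norm_nonneg _) hz)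
    have h1 := ((hs.hasSum.tendsto_sum_nat.const_mul z).sub h0).div_const (1 - z)
    rw [sub_zero] at h1
    refine h1.congr fun N => ?_
    rw [← one_sub_mul_sum_logPowCoeff, mul_div_cancel_left₀ _ (sub_ne_zero.2 hz1.symm)]
  have hin : ∀ z : ℂ, ‖z‖ < 1 → (-Complex.log (1 - z)) ^ (m + 1) / ((m + 1).factorial : ℂ) =
      (z * ∑' j, e j * z ^ j) / (1 - z) := fun z hz =>
    tendsto_nhds_unique (hasSum_logPowCoeff (m + 1) hz).tendsto_sum_nat
      (hlim z hz.le fun h => by simp [h] at hz)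
  have hcl : x ∈ closure (Metric.ball (0 : ℂ) 1) := by
    rw [closure_ball (0 : ℂ) one_ne_zero]
    exact mem_closedBall_zero_iff.2 hx
  have hne : (𝓝[Metric.ball (0 : ℂ) 1] x).NeBot := mem_closure_iff_nhdsWithin_neBot.1 hcl
  have hl : Tendsto (fun z : ℂ => (-Complex.log (1 - z)) ^ (m + 1) / ((m + 1).factorial : ℂ))
      (𝓝[Metric.ball (0 : ℂ) 1] x)
      (𝓝 ((-Complex.log (1 - x)) ^ (m + 1) / ((m + 1).factorial : ℂ))) := by
    have h1 : ContinuousAt (fun z : ℂ => Complex.log (1 - z)) x :=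
      ContinuousAt.clog (by fun_prop) (one_sub_mem_slitPlane hx hx1)
    exact ((h1.neg.pow (m + 1)).div_const _).tendsto.mono_left nhdsWithin_le_nhds
  have hr : Tendsto (fun z : ℂ => (z * ∑' j, e j * z ^ j) / (1 - z))
      (𝓝[Metric.ball (0 : ℂ) 1] x) (𝓝 ((x * ∑' j, e j * x ^ j) / (1 - x))) := by
    have h1 : ContinuousWithinAt (fun z : ℂ => ∑' j, e j * z ^ j) (Metric.ball (0 : ℂ) 1) x :=
      (hcont x (mem_closedBall_zero_iff.2 hx)).mono Metric.ball_subset_closedBall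
    exact (continuousWithinAt_id.mul h1).div (by fun_prop) (sub_ne_zero.2 hx1.symm)
  -- Both expressions agree in the open disc and are continuous at x from inside it, hence they
  -- agree at x.
  have hxeq := tendsto_nhds_unique (hl.congr' (by
    filter_upwards [self_mem_nhdsWithin] with z hz
    exact hin z (mem_ball_zero_iff.1 hz))) hr
  rw [hxeq]
  exact hlim x hx hx1

/-! ### The limit formula for the Stieltjes constants -/

theorem iteratedDeriv_const_cpow_sub {w : ℂ} (hw : w ≠ 0) (c : ℂ) (m : ℕ) :
    iteratedDeriv m (fun s : ℂ => w ^ (c - s)) =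
      fun s => (-Complex.log w) ^ m * w ^ (c - s) := by
  induction m with
  | zero => simp
  | succ m ih =>
    rw [iteratedDeriv_succ, ih]
    ext s
    have h := (((hasDerivAt_id s).const_sub c).const_cpow (c := w) (Or.inl hw)).const_mul
      ((-Complex.log w) ^ m)
    rw [show (fun s : ℂ => (-Complex.log w) ^ m * w ^ (c - s)) =
      fun s : ℂ => (-Complex.log w) ^ m * w ^ (c - id s) from rfl, h.deriv]
    simp only [id]
    ring

/-- Cauchy's formula for a Taylor coefficient at s = 1. The case c = 0 serves the terms of the
Hurwitz series, c = 1 the remainder. -/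
theorem circleIntegral_const_cpow_sub_div {w : ℂ} (hw : w ≠ 0) (c : ℂ) (m : ℕ) :
    (∮ s in C(1, 1 / 2), w ^ (c - s) / (s - 1) ^ (m + 1)) =
      2 * (Real.pi : ℂ) * Complex.I *
        ((-Complex.log w) ^ m * w ^ (c - 1) / (m.factorial : ℂ)) := by
  have hd : Differentiable ℂ (fun s : ℂ => w ^ (c - s)) := fun s =>
    DifferentiableAt.const_cpow (by fun_prop) (Or.inl hw)
  have h := hd.diffContOnCl.circleIntegral_one_div_sub_center_pow_smul (c := 1) (R := 1 / 2)
    (by norm_num) m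
  rw [iteratedDeriv_const_cpow_sub hw, smul_eq_mul] at h
  calc _ = ∮ s in C(1, 1 / 2), (1 / (s - 1) ^ (m + 1)) • w ^ (c - s) := by
        congr 1
        ext s
        rw [smul_eq_mul]
        ring
    _ = _ := by
        rw [h]
        ring

theorem sub_ne_zero_of_mem_sphere {s : ℂ} (hs : s ∈ Metric.sphere (1 : ℂ) (1 / 2)) :
    s - 1 ≠ 0 := fun h => by
  rw [mem_sphere_iff_norm, h] at hs
  norm_num at hs

theorem hurwitz_partial_sum {a : ℂ} (ha : 0 < a.re) {s : ℂ} (hs : s ≠ 1) (N : ℕ) :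
    a ^ (1 - s) / (s - 1) + ∑ n ∈ Finset.range N, hurwitzTerm a s n =
      ∑ n ∈ Finset.range N, ((n : ℂ) + a) ^ (0 - s) + ((N : ℂ) + a) ^ (1 - s) / (s - 1) := by
  induction N with
  | zero => simp
  | succ N ih =>
    rw [Finset.sum_range_succ, Finset.sum_range_succ, ← add_assoc, ih, hurwitzTerm_eq ha hs,
      zero_sub]
    ring

/-- The limit formula for the generalized Stieltjes constants. -/
theorem tendsto_stieltjesGamma {a : ℂ} (ha : 0 < a.re) (l : ℕ) :
    Tendsto (fun N : ℕ => ∑ n ∈ Finset.range N,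
        (-Complex.log ((n : ℂ) + a)) ^ l / ((n : ℂ) + a) +
        (-Complex.log ((N : ℂ) + a)) ^ (l + 1) / ((l : ℂ) + 1)) atTop
      (𝓝 ((-1) ^ l * stieltjesGamma l a)) := by
  have ha0 : a ≠ 0 := fun h => by simp [h] at ha
  have ha' : 0 < ‖a‖ := norm_pos_iff.2 ha0
  have hA : 0 < min ‖a‖ 1 := lt_min ha' one_pos
  -- On this circle Re s ≥ 1/2, so the n-th correction is O(|n + a|^{-3/2}) uniformly, and the limit
  -- may be taken under the integral.
  have hbound : ∀ (n : ℕ), ∀ s ∈ Metric.sphere (1 : ℂ) (1 / 2),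
      ‖hurwitzTerm a s n / (s - 1) ^ (l + 1)‖ ≤
        (3 / 2) * (‖(n : ℂ) + a‖ ^ (-(3 / 2) : ℝ) * (min ‖a‖ 1) ^ (-1 : ℝ) *
          Real.exp (Real.pi * (1 / 2))) * 2 ^ (l + 1) := by
    intro n s hs
    have hs1 := mem_sphere_iff_norm.1 hs
    have hre := Complex.abs_re_le_norm (s - 1)
    have him := Complex.abs_im_le_norm (s - 1)
    rw [hs1, Complex.sub_re, Complex.one_re, abs_le] at hre
    rw [hs1, Complex.sub_im, Complex.one_im, sub_zero] at him
    have hnorm : ‖s‖ ≤ 3 / 2 := by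
      have := norm_add_le (s - 1) 1
      rw [sub_add_cancel, hs1, norm_one] at this
      linarith
    have hx : min ‖a‖ 1 ≤ ‖(n : ℂ) + a‖ := (min_le_left _ _).trans (norm_le_norm_nat_add ha n)
    have hx0 : 0 < ‖(n : ℂ) + a‖ := hA.trans_le hx
    have h1 : ‖(n : ℂ) + a‖ ^ (-s.re - 1) ≤
        ‖(n : ℂ) + a‖ ^ (-(3 / 2) : ℝ) * (min ‖a‖ 1) ^ (-1 : ℝ) := by
      rw [show -s.re - 1 = -(3 / 2) + -(s.re - 1 / 2) by ring, Real.rpow_add hx0]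
      gcongr
      exact (Real.rpow_le_rpow_of_nonpos hA hx (by linarith)).trans
        (Real.rpow_le_rpow_of_exponent_ge hA (min_le_right _ _) (by linarith))
    rw [norm_div, norm_pow, hs1, div_eq_mul_inv, ← inv_pow,
      show ((1 : ℝ) / 2)⁻¹ = 2 by norm_num]
    gcongr
    refine (norm_hurwitzTerm_le ha (by linarith) n).trans ?_
    gcongr
  have hsum : Summable fun n : ℕ => (3 / 2) * (‖(n : ℂ) + a‖ ^ (-(3 / 2) : ℝ) *
      (min ‖a‖ 1) ^ (-1 : ℝ) * Real.exp (Real.pi * (1 / 2))) * 2 ^ (l + 1) :=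
    ((((summable_bound ha (c := 3 / 2) (by norm_num)).mul_right _).mul_right _).mul_left _).mul_right
      _
  have hcpow : ∀ (w c : ℂ), w ≠ 0 → Differentiable ℂ (fun s : ℂ => w ^ (c - s)) := fun w c hw s =>
    DifferentiableAt.const_cpow (by fun_prop) (Or.inl hw)
  have hunif := tendstoUniformlyOn_tsum_nat hsum hbound
  have hcont : ∀ N : ℕ, ContinuousOn (fun s : ℂ => ∑ n ∈ Finset.range N,
      hurwitzTerm a s n / (s - 1) ^ (l + 1)) (Metric.sphere 1 (1 / 2)) := fun N =>
    continuousOn_finsetSum _ fun n _ => ContinuousOn.div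
      (fun s _ => (differentiableAt_hurwitzTerm ha s n).continuousAt.continuousWithinAt)
      (by fun_prop) fun s hs => pow_ne_zero _ (sub_ne_zero_of_mem_sphere hs)
  have hcont0 : ContinuousOn (fun s : ℂ => a ^ (1 - s) / (s - 1) / (s - 1) ^ (l + 1))
      (Metric.sphere 1 (1 / 2)) :=
    (((hcpow a 1 ha0).continuous.continuousOn).div (by fun_prop)
      fun s hs => sub_ne_zero_of_mem_sphere hs).div (by fun_prop)
      fun s hs => pow_ne_zero _ (sub_ne_zero_of_mem_sphere hs)
  have hconst : TendstoUniformlyOn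
      (fun (_ : ℕ) (s : ℂ) => a ^ (1 - s) / (s - 1) / (s - 1) ^ (l + 1))
      (fun s : ℂ => a ^ (1 - s) / (s - 1) / (s - 1) ^ (l + 1)) atTop (Metric.sphere 1 (1 / 2)) :=
    fun u hu => Eventually.of_forall fun _ s _ => refl_mem_uniformity hu
  have hlim := (hconst.add hunif).tendsto_circleIntegral_of_continuousOn (by norm_num)
    (Eventually.of_forall fun N => hcont0.add (hcont N))
  have hpi : (2 * (Real.pi : ℂ) * Complex.I) ≠ 0 := by simp [Real.pi_ne_zero]
  have hfac : (l.factorial : ℂ) ≠ 0 := by exact_mod_cast l.factorial_ne_zero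
  have hl1 : (l : ℂ) + 1 ≠ 0 := by exact_mod_cast l.succ_ne_zero
  -- For finite N the integrand is a sum of powers (n+a)^{-s} and one remainder (N+a)^{1-s}/(s-1).
  -- The extra pole of the remainder raises the order by one, which produces log^{ℓ+1}.
  have hint : ∀ N : ℕ, (∮ s in C(1, 1 / 2), (a ^ (1 - s) / (s - 1) / (s - 1) ^ (l + 1) +
      ∑ n ∈ Finset.range N, hurwitzTerm a s n / (s - 1) ^ (l + 1))) =
      2 * (Real.pi : ℂ) * Complex.I / (l.factorial : ℂ) * (∑ n ∈ Finset.range N,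
        (-Complex.log ((n : ℂ) + a)) ^ l / ((n : ℂ) + a) +
        (-Complex.log ((N : ℂ) + a)) ^ (l + 1) / ((l : ℂ) + 1)) := by
    intro N
    have h1 : (∮ s in C(1, 1 / 2), (a ^ (1 - s) / (s - 1) / (s - 1) ^ (l + 1) +
        ∑ n ∈ Finset.range N, hurwitzTerm a s n / (s - 1) ^ (l + 1))) =
        ∮ s in C(1, 1 / 2), (∑ n ∈ Finset.range N, ((n : ℂ) + a) ^ (0 - s) / (s - 1) ^ (l + 1) +
          ((N : ℂ) + a) ^ (1 - s) / (s - 1) ^ (l + 1 + 1)) := by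
      refine circleIntegral.integral_congr (by norm_num) fun s hs => ?_
      have hs1 := sub_ne_zero_of_mem_sphere hs
      rw [← Finset.sum_div, ← add_div, hurwitz_partial_sum ha (sub_ne_zero.1 hs1),
        ← Finset.sum_div, pow_succ (s - 1) (l + 1), add_div, div_div, mul_comm (s - 1)]
    have hi : ∀ (n m : ℕ) (c : ℂ), ContinuousOn
        (fun s : ℂ => ((n : ℂ) + a) ^ (c - s) / (s - 1) ^ (m + 1)) (Metric.sphere 1 (1 / 2)) :=
      fun n m c => ((hcpow _ c (nat_add_ne_zero ha n)).continuous.continuousOn).div (by fun_prop)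
        fun s hs => pow_ne_zero _ (sub_ne_zero_of_mem_sphere hs)
    rw [h1, circleIntegral.integral_add
      ((continuousOn_finsetSum _ fun n _ => hi n l 0).circleIntegrable (by norm_num))
      ((hi N (l + 1) 1).circleIntegrable (by norm_num)),
      circleIntegral.integral_fun_sum fun n _ => (hi n l 0).circleIntegrable (by norm_num),
      circleIntegral_const_cpow_sub_div (nat_add_ne_zero ha N), mul_add, Finset.mul_sum]
    congr 1
    · refine Finset.sum_congr rfl fun n _ => ?_
      rw [circleIntegral_const_cpow_sub_div (nat_add_ne_zero ha n), zero_sub, Complex.cpow_neg_one]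
      ring
    · rw [sub_self, Complex.cpow_zero, Nat.factorial_succ]
      push_cast
      field_simp
  have hgamma : (∮ s in C(1, 1 / 2), (a ^ (1 - s) / (s - 1) / (s - 1) ^ (l + 1) +
      ∑' n : ℕ, hurwitzTerm a s n / (s - 1) ^ (l + 1))) =
      2 * (Real.pi : ℂ) * Complex.I / (l.factorial : ℂ) * ((-1) ^ l * stieltjesGamma l a) := by
    have h1 : (∮ s in C(1, 1 / 2), (a ^ (1 - s) / (s - 1) / (s - 1) ^ (l + 1) +
        ∑' n : ℕ, hurwitzTerm a s n / (s - 1) ^ (l + 1))) =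
        ∮ s in C(1, 1 / 2), hurwitzZeta a s / (s - 1) ^ (l + 1) := by
      congr 1
      ext s
      rw [tsum_div_const, hurwitzZeta, hurwitzReg, add_div]
    have hsgn : ((-1 : ℂ) ^ l) * (-1) ^ l = 1 := by rw [← mul_pow]; simp
    rw [h1, stieltjesGamma]
    generalize (∮ s in C(1, 1 / 2), hurwitzZeta a s / (s - 1) ^ (l + 1)) = J
    calc J = ((-1 : ℂ) ^ l * (-1) ^ l) * ((2 * (Real.pi : ℂ) * Complex.I) *
          (2 * (Real.pi : ℂ) * Complex.I)⁻¹) * ((l.factorial : ℂ) / (l.factorial : ℂ)) * J := by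
          rw [hsgn, mul_inv_cancel₀ hpi, div_self hfac]
          ring
      _ = _ := by ring
  have hlim2 := hlim.const_mul ((l.factorial : ℂ) / (2 * (Real.pi : ℂ) * Complex.I))
  have hone : (l.factorial : ℂ) / (2 * (Real.pi : ℂ) * Complex.I) *
      (2 * (Real.pi : ℂ) * Complex.I / (l.factorial : ℂ)) = 1 := by
    field_simp
  simp only [Pi.add_apply] at hlim2
  rw [hgamma, ← mul_assoc, hone, one_mul] at hlim2
  refine hlim2.congr fun N => ?_
  rw [hint N, ← mul_assoc, hone, one_mul]

/-! ### The contribution of a single w = n + a -/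

theorem norm_lt_norm_add_one {w : ℂ} (hw : 0 < w.re) : ‖w‖ < ‖w + 1‖ := by
  rw [← sq_lt_sq₀ (norm_nonneg _) (norm_nonneg _), Complex.sq_norm, Complex.sq_norm,
    Complex.normSq_apply, Complex.normSq_apply]
  simp only [Complex.add_re, Complex.add_im, Complex.one_re, Complex.one_im]
  nlinarith

/-- Otherwise u = w + t with t ≥ 0, and moving right from the right half-plane does not decrease the
modulus. -/
theorem sub_mem_slitPlane {w u : ℂ} (hw : 0 < w.re) (hu : ‖u‖ < ‖w‖) :
    w - u ∈ Complex.slitPlane := by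
  by_contra h
  rw [Complex.mem_slitPlane_iff] at h
  push Not at h
  have e : u = w + ((-(w - u).re : ℝ) : ℂ) := by
    refine Complex.ext ?_ ?_
    · simp
    · have := h.2
      simp only [Complex.sub_im] at this
      simp only [Complex.add_im, Complex.ofReal_im, add_zero]
      linarith
  have h1 := norm_le_norm_add hw (t := -(w - u).re) (by linarith [h.1])
  rw [← e] at h1
  linarith

/-- The arguments of w and 1 - u/w are less than π/2 and at most π/2 in absolute value, so their sum
crosses no branch cut. Equality of moduli must be allowed for the boundary case of the convergence
statement. -/
theorem log_sub_eq {w u : ℂ} (hw : 0 < w.re) (hu : ‖u‖ ≤ ‖w‖) (hne : u ≠ w) :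
    Complex.log (w - u) = Complex.log w + Complex.log (1 - u / w) := by
  have hw0 : w ≠ 0 := fun h => by simp [h] at hw
  have hx : ‖u / w‖ ≤ 1 := by
    rw [norm_div]
    exact div_le_one_of_le₀ hu (norm_nonneg _)
  have hx1 : 1 - u / w ≠ 0 := by
    rw [sub_ne_zero, ne_comm, Ne, div_eq_one_iff_eq hw0]
    exact hne
  have h1 : |w.arg| < Real.pi / 2 := Complex.abs_arg_lt_pi_div_two_iff.2 (Or.inl hw)
  have h2 : |(1 - u / w).arg| ≤ Real.pi / 2 := by
    rw [Complex.abs_arg_le_pi_div_two_iff, Complex.sub_re, Complex.one_re]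
    linarith [Complex.re_le_norm (u / w)]
  rw [abs_lt] at h1
  rw [abs_le] at h2
  rw [← (Complex.log_mul_eq_add_log_iff hw0 hx1).2 ⟨by linarith, by linarith⟩]
  congr 1
  field_simp

/-- The sum over `j ≥ 2` of the contributions of `w` to the series of Stirling numbers. -/
noncomputable def logBracket (k : ℕ) (u w : ℂ) : ℂ :=
  (Complex.log w - Complex.log (w - u)) ^ (k + 1) / ((k + 1).factorial : ℂ) -
    (Complex.log w - Complex.log (w + 1 - u)) ^ (k + 1) / ((k + 1).factorial : ℂ) -
    (logPowCoeff (k + 1) 1 : ℂ) / w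

theorem logPowCoeff_one (k : ℕ) : logPowCoeff (k + 1) 1 = if k = 0 then 1 else 0 := by
  cases k with
  | zero => simp [logPowCoeff, Nat.stirlingFirst]
  | succ k => simp [logPowCoeff, Nat.stirlingFirst]

theorem tendsto_logBracket (k : ℕ) {u w : ℂ} (hw : 0 < w.re) (hu : ‖u‖ < ‖w‖)
    (hv : ‖u - 1‖ ≤ ‖w‖) :
    Tendsto (fun N : ℕ => ∑ i ∈ Finset.range N,
      (logPowCoeff (k + 1) (i + 2) : ℂ) * (u ^ (i + 2) - (u - 1) ^ (i + 2)) / w ^ (i + 2)) atTop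
      (𝓝 (logBracket k u w)) := by
  have hw0 : w ≠ 0 := fun h => by simp [h] at hw
  have hne : u ≠ w := fun h => by simp [h] at hu
  -- Equality would give |u| = |w + 1| > |w|; this keeps (u - 1)/w away from the singular point 1.
  have hne' : u - 1 ≠ w := fun h => by
    have h1 := norm_lt_norm_add_one hw
    rw [← h, sub_add_cancel, h] at h1
    linarith
  have key : ∀ x : ℂ, ‖x‖ ≤ ‖w‖ → x ≠ w →
      Tendsto (fun N : ℕ => ∑ j ∈ Finset.range N, (logPowCoeff (k + 1) j : ℂ) * (x / w) ^ j) atTop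
        (𝓝 ((Complex.log w - Complex.log (w - x)) ^ (k + 1) / ((k + 1).factorial : ℂ))) := by
    intro x hx hxw
    have h := tendsto_sum_logPowCoeff k (x := x / w)
      (by rw [norm_div]; exact div_le_one_of_le₀ hx (norm_nonneg _))
      (by rwa [Ne, div_eq_one_iff_eq hw0])
    rwa [show -Complex.log (1 - x / w) = Complex.log w - Complex.log (w - x) by
      rw [log_sub_eq hw hx hxw]; ring] at h
  -- The sum starts at j = 2: the j = 0 terms vanish, and the j = 1 terms leave c(k+1,1)/w because u
  -- - (u - 1) = 1.
  have h := (((key u hu.le hne).sub (key (u - 1) hv hne')).comp (tendsto_add_atTop_nat 2)).sub_const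
    ((logPowCoeff (k + 1) 1 : ℂ) / w)
  rw [show w - (u - 1) = w + 1 - u by ring] at h
  refine h.congr fun N => ?_
  simp only [Function.comp]
  rw [← Finset.sum_sub_distrib, Finset.sum_range_succ', Finset.sum_range_succ', logPowCoeff_succ_zero]
  rw [show ((0 : ℝ) : ℂ) = 0 from Complex.ofReal_zero]
  have e : ∀ i : ℕ, (logPowCoeff (k + 1) (i + 1 + 1) : ℂ) * (u / w) ^ (i + 1 + 1) -
      (logPowCoeff (k + 1) (i + 1 + 1) : ℂ) * ((u - 1) / w) ^ (i + 1 + 1) =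
      (logPowCoeff (k + 1) (i + 2) : ℂ) * (u ^ (i + 2) - (u - 1) ^ (i + 2)) / w ^ (i + 2) := by
    intro i
    rw [div_pow, div_pow]
    ring
  rw [Finset.sum_congr rfl fun i _ => e i]
  simp only [zero_add, pow_one, zero_mul, sub_zero, add_zero]
  ring

theorem norm_logPow_term_le (k i : ℕ) {u w : ℂ} {ρ : ℝ} (hu : ‖u‖ ≤ ρ) (hv : ‖u - 1‖ ≤ ρ) :
    ‖(logPowCoeff (k + 1) (i + 2) : ℂ) * (u ^ (i + 2) - (u - 1) ^ (i + 2)) / w ^ (i + 2)‖ ≤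
      2 * (ρ / ‖w‖) ^ (i + 2) := by
  rw [norm_div, norm_mul, norm_pow, div_pow, ← mul_div_assoc]
  gcongr ?_ / _
  refine (mul_le_of_le_one_left (norm_nonneg _) (norm_logPowCoeff_le_one _ _)).trans ?_
  refine (norm_sub_le _ _).trans ?_
  rw [norm_pow, norm_pow, two_mul]
  gcongr

theorem hasSum_logBracket (k : ℕ) {u w : ℂ} (hw : 0 < w.re) (hu : ‖u‖ < ‖w‖)
    (hv : ‖u - 1‖ < ‖w‖) :
    HasSum (fun i : ℕ =>
      (logPowCoeff (k + 1) (i + 2) : ℂ) * (u ^ (i + 2) - (u - 1) ^ (i + 2)) / w ^ (i + 2))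
      (logBracket k u w) := by
  set ρ := max ‖u‖ ‖u - 1‖ with hρ
  have hρw : ρ / ‖w‖ < 1 := by
    rw [div_lt_one ((norm_nonneg u).trans_lt hu)]
    exact max_lt hu hv
  have hρ0 : 0 ≤ ρ / ‖w‖ := div_nonneg ((norm_nonneg u).trans (le_max_left _ _)) (norm_nonneg _)
  have hs : Summable fun i : ℕ => 2 * (ρ / ‖w‖) ^ (i + 2) :=
    ((summable_nat_add_iff 2).2 (summable_geometric_of_lt_one hρ0 hρw)).mul_left 2
  have hsum := Summable.of_norm_bounded hs fun i => norm_logPow_term_le (u := u) (w := w) k i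
    (le_max_left _ _) (le_max_right _ _)
  exact (hsum.hasSum_iff_tendsto_nat).2 (tendsto_logBracket k hw hu hv.le)

/-- With the j = 1 term removed the expansion in 1/w starts at order 2, and a geometric series of
ratio at most 1/2 bounds the rest. The decay |w|^{-2} makes the sum over n converge. -/
theorem norm_logBracket_le (k : ℕ) {u w : ℂ} {ρ : ℝ} (hw : 0 < w.re) (hu : ‖u‖ ≤ ρ)
    (hv : ‖u - 1‖ ≤ ρ) (h : 2 * ρ ≤ ‖w‖) :
    ‖logBracket k u w‖ ≤ 4 * ρ ^ 2 * ‖w‖ ^ (-2 : ℝ) := by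
  have hw0 : 0 < ‖w‖ := norm_pos_iff.2 fun h => by simp [h] at hw
  have hρ0 : 0 ≤ ρ := (norm_nonneg u).trans hu
  have hx : ρ / ‖w‖ ≤ 1 / 2 := by
    rw [div_le_div_iff₀ hw0 two_pos]
    linarith
  have hx0 : 0 ≤ ρ / ‖w‖ := by positivity
  have hg := (hasSum_geometric_two).mul_left (2 * (ρ / ‖w‖) ^ 2)
  have h1 := HasSum.norm_le_of_bounded (hasSum_logBracket k hw (by linarith) (by linarith)) hg
    fun i => (norm_logPow_term_le k i hu hv).trans (by
      rw [pow_add, mul_comm ((ρ / ‖w‖) ^ i), ← mul_assoc]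
      gcongr)
  refine h1.trans (le_of_eq ?_)
  rw [Real.rpow_neg hw0.le, Real.rpow_two, div_pow]
  ring

/-! ### Summation over n and holomorphy in u -/

/-- The contribution of `w = n + a` to the continued series `S_k`. -/
noncomputable def lambdaSeriesTerm (r k : ℕ) (a u : ℂ) (n : ℕ) : ℂ :=
  (-1) ^ k * (-Complex.log ((n : ℂ) + a)) ^ r * logBracket k u ((n : ℂ) + a)

/-- The continued series `S_k` as a function of `u = λ / (λ + 1)`. -/
noncomputable def lambdaSeries (r k : ℕ) (a u : ℂ) : ℂ := ∑' n : ℕ, lambdaSeriesTerm r k a u n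

/-- From some N on, |n + a| ≥ 2(R + 1), where R + 1 bounds both |u| and |u - 1|. Since N depends
only on R, the tail is dominated uniformly, and the finitely many remaining terms are treated
separately. -/
theorem exists_lambdaSeriesTerm_bound {a : ℂ} (ha : 0 < a.re) (r k : ℕ) (R : ℝ) :
    ∃ (N : ℕ) (b : ℕ → ℝ), Summable b ∧
      ∀ u : ℂ, ‖u‖ ≤ R → ∀ n : ℕ, ‖lambdaSeriesTerm r k a u (n + N)‖ ≤ b n := by
  obtain ⟨N, hN⟩ := eventually_atTop.1
    ((tendsto_norm_nat_add ha).eventually_ge_atTop (2 * (R + 1)))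
  refine ⟨N, fun n => (4 * (R + 1) ^ 2) * (‖Complex.log (((n + N : ℕ) : ℂ) + a)‖ ^ r *
    ‖((n + N : ℕ) : ℂ) + a‖ ^ (-2 : ℝ)), ?_, fun u hu n => ?_⟩
  · exact ((summable_nat_add_iff N).2 (summable_log_pow_mul ha r (by norm_num))).mul_left _
  · have hv : ‖u - 1‖ ≤ R + 1 := (norm_sub_le _ _).trans (by rw [norm_one]; linarith)
    have h := norm_logBracket_le k (nat_add_re_pos ha (n + N)) (by linarith) hv
      (hN (n + N) (Nat.le_add_left _ _))
    rw [lambdaSeriesTerm, norm_mul, norm_mul, norm_pow, norm_neg, norm_one, one_pow, one_mul,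
      norm_pow, norm_neg]
    refine (mul_le_mul_of_nonneg_left h (by positivity)).trans (le_of_eq ?_)
    ring

theorem summable_lambdaSeriesTerm {a : ℂ} (ha : 0 < a.re) (r k : ℕ) (u : ℂ) :
    Summable (lambdaSeriesTerm r k a u) := by
  obtain ⟨N, b, hb, h⟩ := exists_lambdaSeriesTerm_bound ha r k ‖u‖
  exact (summable_nat_add_iff N).1 (Summable.of_norm_bounded hb (h u le_rfl))

theorem differentiableOn_lambdaSeriesTerm {a : ℂ} (ha : 0 < a.re) (r k n : ℕ) :
    DifferentiableOn ℂ (fun u => lambdaSeriesTerm r k a u n) (Metric.ball 0 ‖a‖) := by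
  intro u hu
  have hu1 : ‖u‖ < ‖(n : ℂ) + a‖ := (mem_ball_zero_iff.1 hu).trans_le (norm_le_norm_nat_add ha n)
  have hw := nat_add_re_pos ha n
  have h1 := sub_mem_slitPlane hw hu1
  have h2 : (n : ℂ) + a + 1 - u ∈ Complex.slitPlane := by
    refine sub_mem_slitPlane ?_ (hu1.trans (norm_lt_norm_add_one hw))
    rw [Complex.add_re, Complex.one_re]
    linarith
  have h3 : DifferentiableAt ℂ (fun u : ℂ => Complex.log ((n : ℂ) + a - u)) u :=
    DifferentiableAt.clog (by fun_prop) h1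
  have h4 : DifferentiableAt ℂ (fun u : ℂ => Complex.log ((n : ℂ) + a + 1 - u)) u :=
    DifferentiableAt.clog (by fun_prop) h2
  refine DifferentiableAt.differentiableWithinAt ?_
  unfold lambdaSeriesTerm logBracket
  fun_prop

theorem differentiableOn_lambdaSeries {a : ℂ} (ha : 0 < a.re) (r k : ℕ) :
    DifferentiableOn ℂ (lambdaSeries r k a) (Metric.ball 0 ‖a‖) := by
  obtain ⟨N, b, hb, h⟩ := exists_lambdaSeriesTerm_bound ha r k ‖a‖
  have h1 := Complex.differentiableOn_tsum_of_summable_norm hb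
    (fun n => differentiableOn_lambdaSeriesTerm ha r k (n + N)) Metric.isOpen_ball
    (fun n u hu => h u (mem_ball_zero_iff.1 hu).le n)
  have h2 : DifferentiableOn ℂ (fun u => ∑ n ∈ Finset.range N, lambdaSeriesTerm r k a u n)
      (Metric.ball 0 ‖a‖) :=
    DifferentiableOn.fun_sum fun n _ => differentiableOn_lambdaSeriesTerm ha r k n
  refine (h2.add h1).congr fun u _ => ?_
  exact ((summable_lambdaSeriesTerm ha r k u).sum_add_tsum_nat_add N).symm

/-! ### Telescoping and the formula in u -/

/-- The binomial theorem for exponent ℓ + 1 without its B^0 term, since ℓ!/((ℓ-k)!(k+1)!) is the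
binomial coefficient of ℓ+1 over k+1 divided by ℓ+1. -/
theorem sum_factorial_mul_pow (l : ℕ) (A B : ℂ) :
    ∑ k ∈ Finset.range (l + 1), (l.factorial : ℂ) / ((l - k).factorial : ℂ) *
      (A ^ (l - k) * (B ^ (k + 1) / ((k + 1).factorial : ℂ))) =
      ((A + B) ^ (l + 1) - A ^ (l + 1)) / ((l : ℂ) + 1) := by
  have hl1 : (l : ℂ) + 1 ≠ 0 := by exact_mod_cast l.succ_ne_zero
  rw [add_comm A B, add_pow, Finset.sum_range_succ' _ (l + 1)]
  simp only [pow_zero, one_mul, Nat.sub_zero, Nat.choose_zero_right, Nat.cast_one, mul_one,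
    add_sub_cancel_right, Finset.sum_div]
  refine Finset.sum_congr rfl fun k hk => ?_
  have hk' : k ≤ l := Nat.lt_succ_iff.1 (Finset.mem_range.1 hk)
  have h := congrArg (Nat.cast (R := ℂ))
    (Nat.choose_mul_factorial_mul_factorial (Nat.succ_le_succ hk'))
  rw [Nat.succ_sub_succ] at h
  simp only [Nat.succ_eq_add_one, Nat.factorial_succ l] at h
  push_cast at h
  have h1 : ((l - k).factorial : ℂ) ≠ 0 := by exact_mod_cast (l - k).factorial_ne_zero
  have h2 : ((k + 1).factorial : ℂ) ≠ 0 := by exact_mod_cast (k + 1).factorial_ne_zero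
  rw [Nat.add_sub_add_right, eq_div_iff hl1]
  field_simp
  linear_combination (-(A ^ (l - k) * B ^ (k + 1))) * h

/-- With A = -log w and B = log w - log(w-u), A + B is -log(w-u), and likewise for w+1-u. The two
A^{ℓ+1} cancel, and the j = 1 correction survives only for k = 0. -/
theorem sum_lambdaSeriesTerm {a : ℂ} (l : ℕ) (u : ℂ) (n : ℕ) :
    ∑ k ∈ Finset.range (l + 1), (l.factorial : ℂ) * (-1) ^ k / ((l - k).factorial : ℂ) *
      lambdaSeriesTerm (l - k) k a u n =
      ((-Complex.log ((n : ℂ) + a - u)) ^ (l + 1) / ((l : ℂ) + 1) -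
        (-Complex.log (((n + 1 : ℕ) : ℂ) + a - u)) ^ (l + 1) / ((l : ℂ) + 1)) -
        (-Complex.log ((n : ℂ) + a)) ^ l / ((n : ℂ) + a) := by
  rw [show ((n + 1 : ℕ) : ℂ) + a - u = (n : ℂ) + a + 1 - u by push_cast; ring]
  set w := (n : ℂ) + a with hw
  have h1 := sum_factorial_mul_pow l (-Complex.log w) (Complex.log w - Complex.log (w - u))
  have h2 := sum_factorial_mul_pow l (-Complex.log w) (Complex.log w - Complex.log (w + 1 - u))
  have h3 : ∑ k ∈ Finset.range (l + 1), (l.factorial : ℂ) / ((l - k).factorial : ℂ) *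
      ((-Complex.log w) ^ (l - k) * ((logPowCoeff (k + 1) 1 : ℂ) / w)) =
      (-Complex.log w) ^ l / w := by
    rw [Finset.sum_eq_single 0]
    · have hl : (l.factorial : ℂ) ≠ 0 := by exact_mod_cast l.factorial_ne_zero
      rw [logPowCoeff_one]
      simp only [Nat.sub_zero, div_self hl, if_true, Complex.ofReal_one]
      ring
    · intro k _ hk
      simp [logPowCoeff_one, hk]
    · simp
  calc _ = ∑ k ∈ Finset.range (l + 1), ((l.factorial : ℂ) / ((l - k).factorial : ℂ) *
        ((-Complex.log w) ^ (l - k) *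
          ((Complex.log w - Complex.log (w - u)) ^ (k + 1) / ((k + 1).factorial : ℂ))) -
        (l.factorial : ℂ) / ((l - k).factorial : ℂ) *
        ((-Complex.log w) ^ (l - k) *
          ((Complex.log w - Complex.log (w + 1 - u)) ^ (k + 1) / ((k + 1).factorial : ℂ))) -
        (l.factorial : ℂ) / ((l - k).factorial : ℂ) *
          ((-Complex.log w) ^ (l - k) * ((logPowCoeff (k + 1) 1 : ℂ) / w))) := by
        refine Finset.sum_congr rfl fun k _ => ?_
        have hs : ((-1 : ℂ) ^ k) * (-1) ^ k = 1 := by rw [← mul_pow]; simp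
        rw [lambdaSeriesTerm, logBracket, ← hw]
        linear_combination ((l.factorial : ℂ) / ((l - k).factorial : ℂ) *
          (-Complex.log w) ^ (l - k) *
          ((Complex.log w - Complex.log (w - u)) ^ (k + 1) / ((k + 1).factorial : ℂ) -
            (Complex.log w - Complex.log (w + 1 - u)) ^ (k + 1) / ((k + 1).factorial : ℂ) -
            (logPowCoeff (k + 1) 1 : ℂ) / w)) * hs
    _ = _ := by
        rw [Finset.sum_sub_distrib, Finset.sum_sub_distrib, h1, h2, h3]
        ring

/-- In the binomial expansion every term carries a factor log w - log(w-u) = O(1/|w|), which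
outweighs any power of log w. -/
theorem tendsto_log_pow_sub {a : ℂ} (ha : 0 < a.re) (l : ℕ) (u : ℂ) :
    Tendsto (fun N : ℕ => ((-Complex.log ((N : ℂ) + a - u)) ^ (l + 1) -
      (-Complex.log ((N : ℂ) + a)) ^ (l + 1)) / ((l : ℂ) + 1)) atTop (𝓝 0) := by
  have hB : ∀ᶠ N : ℕ in atTop,
      ‖Complex.log ((N : ℂ) + a) - Complex.log ((N : ℂ) + a - u)‖ ≤
        (3 / 2 * ‖u‖) * (1 / ‖(N : ℂ) + a‖) := by
    filter_upwards [(tendsto_norm_nat_add ha).eventually_ge_atTop (2 * ‖u‖)] with N hN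
    have hw := nat_add_re_pos ha N
    have hw0 : 0 < ‖(N : ℂ) + a‖ := norm_pos_iff.2 (nat_add_ne_zero ha N)
    have hu : ‖u‖ < ‖(N : ℂ) + a‖ := by linarith [norm_nonneg u]
    have hx : ‖-(u / ((N : ℂ) + a))‖ ≤ 1 / 2 := by
      rw [norm_neg, norm_div, div_le_div_iff₀ hw0 two_pos]
      linarith
    have h := Complex.norm_log_one_add_half_le_self hx
    rw [log_sub_eq hw hu.le (fun h => by simp [h] at hu), sub_add_cancel_left, norm_neg,
      sub_eq_add_neg]
    refine h.trans (le_of_eq ?_)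
    rw [norm_neg, norm_div]
    ring
  have hAB : ∀ r : ℕ, Tendsto (fun N : ℕ => (-Complex.log ((N : ℂ) + a)) ^ r *
      (Complex.log ((N : ℂ) + a) - Complex.log ((N : ℂ) + a - u))) atTop (𝓝 0) := by
    intro r
    have h1 := (tendsto_log_pow_div ha r).const_mul (3 / 2 * ‖u‖)
    rw [mul_zero] at h1
    refine squeeze_zero_norm' ?_ h1
    filter_upwards [hB] with N hN
    rw [norm_mul, norm_pow, norm_neg]
    refine (mul_le_mul_of_nonneg_left hN (by positivity)).trans (le_of_eq ?_)
    ring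
  have hB0 := hAB 0
  simp only [pow_zero, one_mul] at hB0
  have h : Tendsto (fun N : ℕ => ∑ k ∈ Finset.range (l + 1),
      (l.factorial : ℂ) / ((l - k).factorial : ℂ) * ((-Complex.log ((N : ℂ) + a)) ^ (l - k) *
        ((Complex.log ((N : ℂ) + a) - Complex.log ((N : ℂ) + a - u)) ^ (k + 1) /
          ((k + 1).factorial : ℂ)))) atTop (𝓝 (∑ k ∈ Finset.range (l + 1), 0)) := by
    refine tendsto_finsetSum _ fun k _ => ?_
    have h1 := ((hAB (l - k)).mul (hB0.pow k)).const_mul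
      ((l.factorial : ℂ) / ((l - k).factorial : ℂ) / ((k + 1).factorial : ℂ))
    rw [zero_mul, mul_zero] at h1
    refine h1.congr fun N => ?_
    ring
  rw [Finset.sum_const_zero] at h
  refine h.congr fun N => ?_
  rw [sum_factorial_mul_pow]
  congr 3
  ring

/-- The formula for the generalized Stieltjes constants in terms of `u = λ / (λ + 1)`. -/
theorem stieltjesGamma_eq_lambdaSeries {a : ℂ} (ha : 0 < a.re) (l : ℕ) (u : ℂ) :
    (-1) ^ l * stieltjesGamma l a =
      (-1) ^ (l + 1) * Complex.log (a - u) ^ (l + 1) / ((l : ℂ) + 1) -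
        ∑ k ∈ Finset.range (l + 1),
          (l.factorial : ℂ) * (-1) ^ k / ((l - k).factorial : ℂ) * lambdaSeries (l - k) k a u := by
  have h1 : HasSum (fun n : ℕ => ∑ k ∈ Finset.range (l + 1),
      (l.factorial : ℂ) * (-1) ^ k / ((l - k).factorial : ℂ) * lambdaSeriesTerm (l - k) k a u n)
      (∑ k ∈ Finset.range (l + 1),
        (l.factorial : ℂ) * (-1) ^ k / ((l - k).factorial : ℂ) * lambdaSeries (l - k) k a u) :=
    hasSum_sum fun k _ => (summable_lambdaSeriesTerm ha (l - k) k u).hasSum.mul_left _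
  have h2 := (h1.tendsto_sum_nat.add (tendsto_log_pow_sub ha l u)).add
    (tendsto_stieltjesGamma ha l)
  have h3 : (-1 : ℂ) ^ (l + 1) * Complex.log (a - u) ^ (l + 1) / ((l : ℂ) + 1) =
      (-Complex.log (a - u)) ^ (l + 1) / ((l : ℂ) + 1) := by
    rw [← mul_pow, neg_one_mul]
  -- The three sequences in `h2` add up to the constant T(0) for every N. The cancellation is
  -- algebraic, so no restriction on u enters.
  have h4 := tendsto_nhds_unique h2 ((tendsto_const_nhds
    (x := (-Complex.log (a - u)) ^ (l + 1) / ((l : ℂ) + 1))).congr fun N => by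
      simp only [sum_lambdaSeriesTerm]
      rw [Finset.sum_sub_distrib, Finset.sum_range_sub' (fun n : ℕ =>
        (-Complex.log ((n : ℂ) + a - u)) ^ (l + 1) / ((l : ℂ) + 1)) N, Nat.cast_zero, zero_add]
      ring)
  rw [h3, ← h4]
  ring

/-! ### Convergence of the Stirling series -/

/-- The summand of `S_k` with index `i + 2`, as a function of `u = λ / (λ + 1)`. -/
noncomputable def stirlingTerm (r k : ℕ) (a u : ℂ) (i : ℕ) : ℂ :=
  (-1) ^ k * ((logPowCoeff (k + 1) (i + 2) : ℂ) * (u ^ (i + 2) - (u - 1) ^ (i + 2))) *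
    hurwitzZetaDeriv r (i + 2) a

theorem lambdaTerm_eq (l : ℕ) (a : ℂ) {lam : ℂ} (hlam : lam ≠ -1) (k i : ℕ) :
    lambdaTerm l a lam k (i + 2) = stirlingTerm (l - k) k a (lam / (lam + 1)) i := by
  have h : lam + 1 ≠ 0 := fun h => hlam (eq_neg_of_add_eq_zero_left h)
  have hv : lam / (lam + 1) - 1 = -1 / (lam + 1) := by
    field_simp
    ring
  have hs : ((-1 : ℂ) ^ i) * (-1) ^ i = 1 := by rw [← mul_pow]; simp
  rw [lambdaTerm, stirlingTerm, hv, div_pow, div_pow, ← sub_div, logPowCoeff, stirlingS]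
  push_cast
  rw [show i + 2 + 1 = i + 3 from rfl, show i + 2 + (k + 1) = i + k + 3 by ring, pow_add _ i 3,
    pow_add _ (i + k) 3, pow_add _ i k]
  linear_combination ((lam ^ (i + 2) - (-1) ^ (i + 2)) / (lam + 1) ^ (i + 2) *
    (1 / ((i + 2).factorial : ℂ)) * (-1) ^ k * (Nat.stirlingFirst (i + 2) (k + 1) : ℂ) *
    hurwitzZetaDeriv (l - k) (i + 2) a) * hs

/-- Inside the disc of convergence the series of Stirling numbers converges absolutely to the
sum over `n`. -/
theorem hasSum_stirlingTerm {b : ℂ} (hb : 0 < b.re) (r k : ℕ) {u : ℂ} (hu : ‖u‖ < ‖b‖)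
    (hv : ‖u - 1‖ < ‖b‖) : HasSum (stirlingTerm r k b u) (lambdaSeries r k b u) := by
  set ρ := max ‖u‖ ‖u - 1‖ with hρ
  have hb0 : 0 < ‖b‖ := (norm_nonneg u).trans_lt hu
  have hρ0 : 0 ≤ ρ := (norm_nonneg u).trans (le_max_left _ _)
  have hρb : ρ / ‖b‖ < 1 := by
    rw [div_lt_one hb0]
    exact max_lt hu hv
  let F : ℕ × ℕ → ℂ := fun p => (-1) ^ k * (-Complex.log ((p.1 : ℂ) + b)) ^ r *
    ((logPowCoeff (k + 1) (p.2 + 2) : ℂ) * (u ^ (p.2 + 2) - (u - 1) ^ (p.2 + 2)) /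
      ((p.1 : ℂ) + b) ^ (p.2 + 2))
  -- Since |n + b| ≥ |b|, two of the factors ρ/|n + b| give decay in n and the other i are at most
  -- ρ/|b| < 1. So F is dominated by a product of a summable sequence in n and a geometric one in i.
  have hF : Summable F := by
    have h1 := summable_log_pow_mul hb r (c := 2) (by norm_num)
    have h2 : Summable fun i : ℕ => 2 * ρ ^ 2 * (ρ / ‖b‖) ^ i :=
      (summable_geometric_of_lt_one (by positivity) hρb).mul_left _
    refine Summable.of_norm_bounded
      (h1.mul_of_nonneg h2 (fun n => by positivity) fun i => by positivity) ?_
    rintro ⟨n, i⟩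
    have hw0 : 0 < ‖(n : ℂ) + b‖ := norm_pos_iff.2 (nat_add_ne_zero hb n)
    have h3 := norm_logPow_term_le (u := u) (w := (n : ℂ) + b) k i (le_max_left _ _)
      (le_max_right _ _)
    simp only [F]
    rw [norm_mul, norm_mul, norm_pow, norm_neg, norm_one, one_pow, one_mul, norm_pow, norm_neg]
    calc _ ≤ ‖Complex.log ((n : ℂ) + b)‖ ^ r * (2 * (ρ / ‖(n : ℂ) + b‖) ^ (i + 2)) := by gcongr
      _ = ‖Complex.log ((n : ℂ) + b)‖ ^ r * (2 * ((ρ / ‖(n : ℂ) + b‖) ^ i *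
            (ρ ^ 2 * ‖(n : ℂ) + b‖ ^ (-2 : ℝ)))) := by
          rw [Real.rpow_neg hw0.le, Real.rpow_two, pow_add, div_pow ρ _ 2]
          ring
      _ ≤ ‖Complex.log ((n : ℂ) + b)‖ ^ r * (2 * ((ρ / ‖b‖) ^ i *
            (ρ ^ 2 * ‖(n : ℂ) + b‖ ^ (-2 : ℝ)))) := by
          gcongr
          exact norm_le_norm_nat_add hb n
      _ = _ := by ring
  have hrow : ∀ n : ℕ, HasSum (fun i : ℕ => F (n, i)) (lambdaSeriesTerm r k b u n) := by
    intro n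
    have h := (hasSum_logBracket k (nat_add_re_pos hb n) (hu.trans_le (norm_le_norm_nat_add hb n))
      (hv.trans_le (norm_le_norm_nat_add hb n))).mul_left
      ((-1) ^ k * (-Complex.log ((n : ℂ) + b)) ^ r)
    rw [← lambdaSeriesTerm] at h
    exact h
  have hcol : ∀ i : ℕ, HasSum (fun n : ℕ => (F ∘ Prod.swap) (i, n)) (stirlingTerm r k b u i) := by
    intro i
    refine ((hasSum_hurwitzZetaDeriv hb r (Nat.le_add_left 2 i)).mul_left ((-1) ^ k *
      ((logPowCoeff (k + 1) (i + 2) : ℂ) * (u ^ (i + 2) - (u - 1) ^ (i + 2))))).congr_fun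
      fun n => ?_
    simp only [F, Function.comp, Prod.swap]
    ring
  have h1 : HasSum (lambdaSeriesTerm r k b u) (∑' p, F p) := hF.hasSum.prod_fiberwise hrow
  have h2 : HasSum (F ∘ Prod.swap) (∑' p, F p) :=
    (Equiv.prodComm ℕ ℕ).hasSum_iff.2 hF.hasSum
  rw [lambdaSeries, h1.tsum_eq]
  exact h2.prod_fiberwise hcol

/-- The series of Stirling numbers converges for `‖u - 1‖ ≤ ‖a‖`, possibly conditionally. -/
theorem tendsto_sum_stirlingTerm {a : ℂ} (ha : 0 < a.re) (r k : ℕ) {u : ℂ} (hu : ‖u‖ < ‖a‖)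
    (hv : ‖u - 1‖ ≤ ‖a‖) :
    Tendsto (fun N : ℕ => ∑ i ∈ Finset.range N, stirlingTerm r k a u i) atTop
      (𝓝 (lambdaSeries r k a u)) := by
  have ha1 : 0 < (a + 1).re := by
    rw [Complex.add_re, Complex.one_re]
    linarith
  have hlt := norm_lt_norm_add_one ha
  have h1 := (tendsto_logBracket k ha hu hv).const_mul ((-1) ^ k * (-Complex.log a) ^ r)
  have h2 := (hasSum_stirlingTerm ha1 r k (hu.trans hlt) (hv.trans_lt hlt)).tendsto_sum_nat
  have e : lambdaSeries r k a u = (-1) ^ k * (-Complex.log a) ^ r * logBracket k u a +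
      lambdaSeries r k (a + 1) u := by
    -- Only n = 0 can be conditionally convergent. The terms n ≥ 1 form the series for a + 1, where
    -- |u - 1| ≤ |a| < |a + 1| gives absolute convergence.
    rw [lambdaSeries, (summable_lambdaSeriesTerm ha r k u).tsum_eq_zero_add, lambdaSeries]
    congr 1
    · simp [lambdaSeriesTerm]
    · congr 1
      ext n
      rw [lambdaSeriesTerm, lambdaSeriesTerm,
        show ((n + 1 : ℕ) : ℂ) + a = (n : ℂ) + (a + 1) by push_cast; ring]
  rw [e]
  refine (h1.add h2).congr fun N => ?_
  rw [Finset.mul_sum, ← Finset.sum_add_distrib]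
  refine Finset.sum_congr rfl fun i _ => ?_
  rw [stirlingTerm, stirlingTerm, hurwitzZetaDeriv_eq_add ha r (j := i + 2) (by lia)]
  ring

/-! ### The points λ = i and λ = -i, that is u = (1 + i)/2 and u = (1 - i)/2 -/

theorem half_one_add_I_sq : ((1 + Complex.I) / 2) ^ 2 = Complex.I / 2 := by
  rw [div_pow, add_sq, Complex.I_sq]
  ring

theorem half_one_add_I_pow_four : ((1 + Complex.I) / 2) ^ 4 = -1 / 4 := by
  rw [show 4 = 2 * 2 from rfl, pow_mul, half_one_add_I_sq, div_pow, Complex.I_sq]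
  norm_num

theorem half_one_sub_I_sq : ((1 - Complex.I) / 2) ^ 2 = -Complex.I / 2 := by
  rw [div_pow, sub_sq, Complex.I_sq]
  ring

theorem half_one_sub_I_pow_four : ((1 - Complex.I) / 2) ^ 4 = -1 / 4 := by
  rw [show 4 = 2 * 2 from rfl, pow_mul, half_one_sub_I_sq, div_pow, neg_sq, Complex.I_sq]
  norm_num

theorem norm_half_one_add_I : ‖(1 + Complex.I) / 2‖ < 1 := by
  rw [← sq_lt_one_iff₀ (norm_nonneg _), Complex.sq_norm, Complex.normSq_apply]
  norm_num

theorem norm_half_one_sub_I : ‖(1 - Complex.I) / 2‖ < 1 := by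
  rw [← sq_lt_one_iff₀ (norm_nonneg _), Complex.sq_norm, Complex.normSq_apply]
  norm_num

theorem hasSum_mod_four {f : ℕ → ℂ} {s₀ s₁ s₂ s₃ : ℂ} (h₀ : HasSum (fun q => f (4 * q)) s₀)
    (h₁ : HasSum (fun q => f (4 * q + 1)) s₁) (h₂ : HasSum (fun q => f (4 * q + 2)) s₂)
    (h₃ : HasSum (fun q => f (4 * q + 3)) s₃) : HasSum f (s₀ + s₂ + (s₁ + s₃)) := by
  refine HasSum.even_add_odd (HasSum.even_add_odd ?_ ?_) (HasSum.even_add_odd ?_ ?_)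
  · exact h₀.congr_fun fun q => by rw [show 2 * (2 * q) = 4 * q by ring]
  · exact h₂.congr_fun fun q => by rw [show 2 * (2 * q + 1) = 4 * q + 2 by ring]
  · exact h₁.congr_fun fun q => by rw [show 2 * (2 * q) + 1 = 4 * q + 1 by ring]
  · exact h₃.congr_fun fun q => by rw [show 2 * (2 * q + 1) + 1 = 4 * q + 3 by ring]

theorem half_one_add_I_sub_one : (1 + Complex.I) / 2 - 1 = -((1 - Complex.I) / 2) := by ring

theorem half_one_sub_I_sub_one : (1 - Complex.I) / 2 - 1 = -((1 + Complex.I) / 2) := by ring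

theorem logPowCoeff_eq (k j : ℕ) :
    (-1) ^ k * (logPowCoeff (k + 1) j : ℂ) =
      (-1) ^ (j + 1) * ((stirlingS j (k + 1) : ℂ) / (j.factorial : ℂ)) := by
  have hs : ((-1 : ℂ) ^ j) * (-1) ^ j = 1 := by rw [← mul_pow]; simp
  rw [logPowCoeff, stirlingS]
  push_cast
  rw [show j + (k + 1) = j + k + 1 by ring, pow_succ _ (j + k), pow_add, pow_succ]
  linear_combination (-((-1) ^ k * ((Nat.stirlingFirst j (k + 1) : ℂ) / (j.factorial : ℂ)))) * hs

theorem stirlingTerm_eq (r k : ℕ) (a u : ℂ) (i : ℕ) :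
    stirlingTerm r k a u i = (-1) ^ (i + 1) * (u ^ (i + 2) - (u - 1) ^ (i + 2)) *
      ((stirlingS (i + 2) (k + 1) : ℂ) / ((i + 2).factorial : ℂ)) *
        hurwitzZetaDeriv r (i + 2) a := by
  rw [stirlingTerm, ← mul_assoc, logPowCoeff_eq, show i + 2 + 1 = i + 1 + 2 from rfl,
    pow_add _ (i + 1) 2]
  ring

theorem neg_one_pow_four_mul (q : ℕ) : (-1 : ℂ) ^ (4 * q) = 1 := by
  rw [pow_mul]
  norm_num

section
variable (r k : ℕ) (a : ℂ) (q : ℕ)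

theorem stirlingTerm_add_four_mul :
    stirlingTerm r k a ((1 + Complex.I) / 2) (4 * q) = -Complex.I *
      ((-1 / 4) ^ q / ((4 * q + 2).factorial : ℂ) * (stirlingS (4 * q + 2) (k + 1) : ℂ) *
        hurwitzZetaDeriv r (4 * q + 2) a) := by
  rw [stirlingTerm_eq, half_one_add_I_sub_one, neg_pow ((1 - Complex.I) / 2), pow_succ (-1 : ℂ),
    pow_add _ (4 * q) 2, pow_add _ (4 * q) 2, pow_add _ (4 * q) 2, neg_one_pow_four_mul, pow_mul,
    pow_mul, half_one_add_I_pow_four, half_one_sub_I_pow_four, half_one_add_I_sq,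
    half_one_sub_I_sq]
  ring

theorem stirlingTerm_sub_four_mul :
    stirlingTerm r k a ((1 - Complex.I) / 2) (4 * q) = Complex.I *
      ((-1 / 4) ^ q / ((4 * q + 2).factorial : ℂ) * (stirlingS (4 * q + 2) (k + 1) : ℂ) *
        hurwitzZetaDeriv r (4 * q + 2) a) := by
  rw [stirlingTerm_eq, half_one_sub_I_sub_one, neg_pow ((1 + Complex.I) / 2), pow_succ (-1 : ℂ),
    pow_add _ (4 * q) 2, pow_add _ (4 * q) 2, pow_add _ (4 * q) 2, neg_one_pow_four_mul, pow_mul,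
    pow_mul, half_one_add_I_pow_four, half_one_sub_I_pow_four, half_one_add_I_sq,
    half_one_sub_I_sq]
  ring

theorem neg_one_pow_mul_half_pow : (-1 : ℂ) ^ q * (1 / 2) ^ (2 * q) = (-1 / 4) ^ q := by
  rw [pow_mul, ← mul_pow]
  norm_num

theorem half_one_add_I_pow_three :
    ((1 + Complex.I) / 2) ^ 3 + ((1 - Complex.I) / 2) ^ 3 = -1 / 2 := by
  rw [pow_succ, pow_succ ((1 - Complex.I) / 2), half_one_add_I_sq, half_one_sub_I_sq]
  linear_combination (1 / 2) * Complex.I_sq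

theorem stirlingTerm_add_four_mul_add_one :
    stirlingTerm r k a ((1 + Complex.I) / 2) (4 * q + 1) =
      -((-1) ^ q * (1 / 2) ^ (2 * q + 1) * (1 / ((4 * q + 3).factorial : ℂ)) *
        (stirlingS (4 * q + 3) (k + 1) : ℂ) * hurwitzZetaDeriv r (4 * q + 3) a) := by
  rw [stirlingTerm_eq, show 4 * q + 1 + 2 = 4 * q + 3 from rfl,
    show 4 * q + 1 + 1 = 4 * q + 2 from rfl, half_one_add_I_sub_one,
    neg_pow ((1 - Complex.I) / 2), pow_add _ (4 * q) 2, pow_add _ (4 * q) 3, pow_add _ (4 * q) 3,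
    pow_add _ (4 * q) 3, neg_one_pow_four_mul, pow_mul, pow_mul, half_one_add_I_pow_four,
    half_one_sub_I_pow_four, pow_succ (1 / 2 : ℂ),
    ← mul_assoc ((-1 : ℂ) ^ q), neg_one_pow_mul_half_pow]
  linear_combination ((-1 / 4) ^ q *
    ((stirlingS (4 * q + 3) (k + 1) : ℂ) / ((4 * q + 3).factorial : ℂ)) *
    hurwitzZetaDeriv r (4 * q + 3) a) * half_one_add_I_pow_three

/-- Here j is a multiple of 4, and u and u - 1 have the same fourth power -1/4. -/
theorem stirlingTerm_add_four_mul_add_two :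
    stirlingTerm r k a ((1 + Complex.I) / 2) (4 * q + 2) = 0 := by
  rw [stirlingTerm_eq, show 4 * q + 2 + 2 = 4 * (q + 1) by ring, half_one_add_I_sub_one,
    neg_pow ((1 - Complex.I) / 2), neg_one_pow_four_mul, pow_mul, pow_mul,
    half_one_add_I_pow_four, half_one_sub_I_pow_four]
  ring

/-- The class j ≡ 1 mod 4 starts at j = 5, because j = 1 is absent from the series; hence the shift
to q + 1. -/
theorem stirlingTerm_add_four_mul_add_three :
    stirlingTerm r k a ((1 + Complex.I) / 2) (4 * q + 3) =
      (-1) ^ (q + 1) * (1 / 2) ^ (2 * (q + 1)) * (1 / ((4 * (q + 1) + 1).factorial : ℂ)) *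
        (stirlingS (4 * (q + 1) + 1) (k + 1) : ℂ) * hurwitzZetaDeriv r (4 * (q + 1) + 1) a := by
  rw [stirlingTerm_eq, show 4 * q + 3 + 2 = 4 * (q + 1) + 1 by ring,
    show 4 * q + 3 + 1 = 4 * (q + 1) by ring, half_one_add_I_sub_one,
    neg_pow ((1 - Complex.I) / 2), pow_succ _ (4 * (q + 1)), pow_succ _ (4 * (q + 1)),
    pow_succ _ (4 * (q + 1)), neg_one_pow_four_mul, pow_mul, pow_mul, half_one_add_I_pow_four,
    half_one_sub_I_pow_four, neg_one_pow_mul_half_pow]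
  ring

/-- The terms of odd index `i + 2` agree at `λ = i` and `λ = -i`. -/
theorem stirlingTerm_sub_of_odd {i : ℕ} (hi : Odd i) :
    stirlingTerm r k a ((1 - Complex.I) / 2) i = stirlingTerm r k a ((1 + Complex.I) / 2) i := by
  have hi2 : Odd (i + 2) := hi.add_even even_two
  rw [stirlingTerm, stirlingTerm, half_one_add_I_sub_one, half_one_sub_I_sub_one, hi2.neg_pow,
    hi2.neg_pow]
  ring

/-- Replacing λ = i by λ = -i replaces u by 1 - u, which exchanges u^j and (u-1)^j for even j. -/
theorem stirlingTerm_sub_of_even {i : ℕ} (hi : Even i) :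
    stirlingTerm r k a ((1 - Complex.I) / 2) i = -stirlingTerm r k a ((1 + Complex.I) / 2) i := by
  have hi2 : Even (i + 2) := hi.add even_two
  rw [stirlingTerm, stirlingTerm, half_one_add_I_sub_one, half_one_sub_I_sub_one, hi2.neg_pow,
    hi2.neg_pow]
  ring

end

/-- The three subseries of `S_k(i)`, and the values of `S_k` at `λ = i` and `λ = -i`. -/
theorem exists_hasSum_lambdaSeries_I {a : ℂ} (ha : 0 < a.re) (ha1 : 1 ≤ ‖a‖) (r k : ℕ) :
    ∃ A B C : ℂ,
      HasSum (fun p : ℕ => (-1) ^ (p + 1) * (1 / 2) ^ (2 * (p + 1)) *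
        (1 / ((4 * (p + 1) + 1).factorial : ℂ)) * (stirlingS (4 * (p + 1) + 1) (k + 1) : ℂ) *
        hurwitzZetaDeriv r (4 * (p + 1) + 1) a) A ∧
      HasSum (fun q : ℕ => (-1) ^ q * (1 / 2) ^ (2 * q + 1) *
        (1 / ((4 * q + 3).factorial : ℂ)) * (stirlingS (4 * q + 3) (k + 1) : ℂ) *
        hurwitzZetaDeriv r (4 * q + 3) a) B ∧
      HasSum (fun q : ℕ => (-1 / 4) ^ q / ((4 * q + 2).factorial : ℂ) *
        (stirlingS (4 * q + 2) (k + 1) : ℂ) * hurwitzZetaDeriv r (4 * q + 2) a) C ∧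
      lambdaSeries r k a ((1 + Complex.I) / 2) = A - B - Complex.I * C ∧
      lambdaSeries r k a ((1 - Complex.I) / 2) = A - B + Complex.I * C := by
  have hI : ‖(1 + Complex.I) / 2‖ < ‖a‖ := norm_half_one_add_I.trans_le ha1
  have hI' : ‖(1 - Complex.I) / 2‖ < ‖a‖ := norm_half_one_sub_I.trans_le ha1
  have h1 := hasSum_stirlingTerm ha r k hI (by rwa [half_one_add_I_sub_one, norm_neg])
  have h2 := hasSum_stirlingTerm ha r k hI' (by rwa [half_one_sub_I_sub_one, norm_neg])
  -- Absolute convergence permits splitting by residues mod 4.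
  have hs : ∀ c : ℕ, Summable fun q : ℕ => stirlingTerm r k a ((1 + Complex.I) / 2) (4 * q + c) :=
    fun c => h1.summable.comp_injective (i := fun q : ℕ => 4 * q + c) fun x y hxy => by
      simp only at hxy
      lia
  have hA := ((hs 3).congr fun q => stirlingTerm_add_four_mul_add_three r k a q).hasSum
  have hB := ((hs 1).neg.congr fun q => (neg_eq_iff_eq_neg.2
    (stirlingTerm_add_four_mul_add_one r k a q))).hasSum
  have hC := (((hs 0).mul_left Complex.I).congr fun q => by
    rw [add_zero, stirlingTerm_add_four_mul, ← mul_assoc, mul_neg, Complex.I_mul_I, neg_neg,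
      one_mul]).hasSum
  refine ⟨_, _, _, hA, hB, hC, ?_, ?_⟩
  · refine (h1.unique (hasSum_mod_four
      ((hC.mul_left (-Complex.I)).congr_fun fun q => stirlingTerm_add_four_mul r k a q)
      (hB.neg.congr_fun fun q => stirlingTerm_add_four_mul_add_one r k a q)
      (hasSum_zero.congr_fun fun q => stirlingTerm_add_four_mul_add_two r k a q)
      (hA.congr_fun fun q => stirlingTerm_add_four_mul_add_three r k a q))).trans ?_
    ring
  · refine (h2.unique (hasSum_mod_four
      ((hC.mul_left Complex.I).congr_fun fun q => stirlingTerm_sub_four_mul r k a q)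
      (hB.neg.congr_fun fun q => (stirlingTerm_sub_of_odd r k a ⟨2 * q, by ring⟩).trans
        (stirlingTerm_add_four_mul_add_one r k a q))
      (hasSum_zero.congr_fun fun q => (stirlingTerm_sub_of_even r k a ⟨2 * q + 1, by ring⟩).trans
        (by rw [stirlingTerm_add_four_mul_add_two, neg_zero]))
      (hA.congr_fun fun q => (stirlingTerm_sub_of_odd r k a ⟨2 * q + 1, by ring⟩).trans
        (stirlingTerm_add_four_mul_add_three r k a q)))).trans ?_
    ring

/-! ### Return from u to λ -/

theorem lambda_div_mem_ball {a lam : ℂ} (h : lam ∈ lambdaDomain a) :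
    lam / (lam + 1) ∈ Metric.ball (0 : ℂ) ‖a‖ := mem_ball_zero_iff.2 h.2

theorem lambda_div_sub_one {lam : ℂ} (h : lam ≠ -1) :
    lam / (lam + 1) - 1 = -(1 / (lam + 1)) := by
  have h : lam + 1 ≠ 0 := fun h' => h (eq_neg_of_add_eq_zero_left h')
  field_simp
  ring

/-- For λ > 0 both |u| = λ/(λ+1) and |u - 1| = 1/(λ+1) are less than 1 ≤ |a|, so the absolutely
convergent case applies. -/
theorem hasSum_lambdaTerm_of_pos {a : ℂ} (ha : 0 < a.re) (ha1 : 1 ≤ ‖a‖) {lam : ℝ} (hlam : 0 < lam)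
    (l k : ℕ) : HasSum (fun i : ℕ => lambdaTerm l a lam k (i + 2))
      (lambdaSeries (l - k) k a ((lam : ℂ) / ((lam : ℂ) + 1))) := by
  have hne : (lam : ℂ) ≠ -1 := fun h => by
    have := congrArg Complex.re h
    simp only [Complex.ofReal_re, Complex.neg_re, Complex.one_re] at this
    linarith
  have hn : ‖(lam : ℂ) + 1‖ = lam + 1 := by
    rw [show (lam : ℂ) + 1 = ((lam + 1 : ℝ) : ℂ) by push_cast; rfl, Complex.norm_real,
      Real.norm_of_nonneg (by positivity)]
  refine (hasSum_stirlingTerm ha (l - k) k ?_ ?_).congr_fun fun i => lambdaTerm_eq l a hne k i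
  · refine lt_of_lt_of_le ?_ ha1
    rw [norm_div, hn, Complex.norm_real, Real.norm_of_nonneg hlam.le, div_lt_one (by positivity)]
    linarith
  · refine lt_of_lt_of_le ?_ ha1
    rw [lambda_div_sub_one hne, norm_neg, norm_div, hn, norm_one, div_lt_one (by positivity)]
    linarith

theorem differentiableOn_lambdaSeries_comp {a : ℂ} (ha : 0 < a.re) (r k : ℕ) :
    DifferentiableOn ℂ (fun lam : ℂ => lambdaSeries r k a (lam / (lam + 1))) (lambdaDomain a) :=
  (differentiableOn_lambdaSeries ha r k).comp
    (DifferentiableOn.div (by fun_prop) (by fun_prop)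
      fun lam h h' => h.1 (eq_neg_of_add_eq_zero_left h'))
    fun _ h => lambda_div_mem_ball h

theorem tendsto_sum_lambdaTerm {a : ℂ} (ha : 0 < a.re) (l k : ℕ) {lam : ℂ}
    (hlam : lam ∈ lambdaDomain a) (h : ‖1 / (lam + 1)‖ ≤ ‖a‖) :
    Tendsto (fun N : ℕ => ∑ i ∈ Finset.range N, lambdaTerm l a lam k (i + 2)) atTop
      (𝓝 (lambdaSeries (l - k) k a (lam / (lam + 1)))) := by
  refine (tendsto_sum_stirlingTerm ha (l - k) k hlam.2 ?_).congr fun N =>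
    Finset.sum_congr rfl fun i _ => (lambdaTerm_eq l a hlam.1 k i).symm
  rwa [lambda_div_sub_one hlam.1, norm_neg]

end HurwitzStieltjes

theorem mainTheorem4 (l : ℕ) :
    -- complex `a` with positive real part and modulus at least one
    (∀ a : ℂ, 0 < a.re → 1 ≤ ‖a‖ →
      -- the formula for real `λ > 0`
      (∀ lam : ℝ, 0 < lam →
        ∃ S : ℕ → ℂ,
          (∀ k ≤ l, HasSum (fun i : ℕ => HurwitzStieltjes.lambdaTerm l a lam k (i + 2)) (S k)) ∧
          (-1) ^ l * HurwitzStieltjes.stieltjesGamma l a =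
            (-1) ^ (l + 1) * Complex.log (a - (lam : ℂ) / ((lam : ℂ) + 1)) ^ (l + 1) / ((l : ℂ) + 1)
              - ∑ k ∈ Finset.range (l + 1),
                  (l.factorial : ℂ) * (-1) ^ k / ((l - k).factorial : ℂ) * S k) ∧
      -- its extension to complex `λ`: convergence, analytic continuation, and the formula
      (∃ S : ℕ → ℂ → ℂ,
        (∀ k ≤ l, DifferentiableOn ℂ (S k) (HurwitzStieltjes.lambdaDomain a)) ∧
        (∀ k ≤ l, ∀ lam ∈ HurwitzStieltjes.lambdaDomain a, ‖1 / (lam + 1)‖ ≤ ‖a‖ →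
          Tendsto (fun N : ℕ => ∑ i ∈ Finset.range N,
            HurwitzStieltjes.lambdaTerm l a lam k (i + 2)) atTop (𝓝 (S k lam))) ∧
        (∀ lam ∈ HurwitzStieltjes.lambdaDomain a,
          (-1) ^ l * HurwitzStieltjes.stieltjesGamma l a =
            (-1) ^ (l + 1) * Complex.log (a - lam / (lam + 1)) ^ (l + 1) / ((l : ℂ) + 1)
              - ∑ k ∈ Finset.range (l + 1),
                  (l.factorial : ℂ) * (-1) ^ k / ((l - k).factorial : ℂ) * S k lam))) ∧
    -- the case `λ = i` with real `a > 1`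
    (∀ a : ℝ, 1 < a →
      ∃ A B C : ℕ → ℂ,
        (∀ k ≤ l, HasSum (fun p : ℕ => (-1) ^ (p + 1) * (1 / 2) ^ (2 * (p + 1)) *
            (1 / ((4 * (p + 1) + 1).factorial : ℂ)) *
            (HurwitzStieltjes.stirlingS (4 * (p + 1) + 1) (k + 1) : ℂ) *
            HurwitzStieltjes.hurwitzZetaDeriv (l - k) (4 * (p + 1) + 1) a) (A k)) ∧
        (∀ k ≤ l, HasSum (fun q : ℕ => (-1) ^ q * (1 / 2) ^ (2 * q + 1) *
            (1 / ((4 * q + 3).factorial : ℂ)) *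
            (HurwitzStieltjes.stirlingS (4 * q + 3) (k + 1) : ℂ) *
            HurwitzStieltjes.hurwitzZetaDeriv (l - k) (4 * q + 3) a) (B k)) ∧
        (∀ k ≤ l, HasSum (fun r : ℕ => (-1 / 4) ^ r / ((4 * r + 2).factorial : ℂ) *
            (HurwitzStieltjes.stirlingS (4 * r + 2) (k + 1) : ℂ) *
            HurwitzStieltjes.hurwitzZetaDeriv (l - k) (4 * r + 2) a) (C k)) ∧
        (-1) ^ l * HurwitzStieltjes.stieltjesGamma l a =
          (-1) ^ (l + 1) *
              (((Complex.log ((a : ℂ) - 1 / 2 - Complex.I / 2) ^ (l + 1) / ((l : ℂ) + 1)).re : ℝ) : ℂ)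
            - ∑ k ∈ Finset.range (l + 1),
                (l.factorial : ℂ) * (-1) ^ k / ((l - k).factorial : ℂ) * (A k - B k) ∧
        ∑ k ∈ Finset.range (l + 1),
            (l.factorial : ℂ) / ((l - k).factorial : ℂ) * (-1) ^ k * C k =
          ((((-1) ^ l * Complex.log ((a : ℂ) - (Complex.I + 1) / 2) ^ (l + 1) /
            ((l : ℂ) + 1)).im : ℝ) : ℂ)) := by
  refine ⟨fun a ha ha1 => ⟨fun lam hlam => ?_, ?_⟩, fun a ha => ?_⟩
  · exact ⟨fun k => HurwitzStieltjes.lambdaSeries (l - k) k a ((lam : ℂ) / ((lam : ℂ) + 1)),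
      fun k _ => HurwitzStieltjes.hasSum_lambdaTerm_of_pos ha ha1 hlam l k,
      HurwitzStieltjes.stieltjesGamma_eq_lambdaSeries ha l _⟩
  · exact ⟨fun k lam => HurwitzStieltjes.lambdaSeries (l - k) k a (lam / (lam + 1)),
      fun k _ => HurwitzStieltjes.differentiableOn_lambdaSeries_comp ha (l - k) k,
      fun k _ lam hlam h => HurwitzStieltjes.tendsto_sum_lambdaTerm ha l k hlam h,
      fun lam _ => HurwitzStieltjes.stieltjesGamma_eq_lambdaSeries ha l _⟩
  · have hre : 0 < (a : ℂ).re := by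
      rw [Complex.ofReal_re]
      linarith
    have hnorm : 1 ≤ ‖(a : ℂ)‖ := by
      rw [Complex.norm_real, Real.norm_of_nonneg (by linarith)]
      exact ha.le
    choose A B C hA hB hC hS hS' using fun k =>
      HurwitzStieltjes.exists_hasSum_lambdaSeries_I hre hnorm (l - k) k
    have h1 := HurwitzStieltjes.stieltjesGamma_eq_lambdaSeries hre l ((1 + Complex.I) / 2)
    have h2 := HurwitzStieltjes.stieltjesGamma_eq_lambdaSeries hre l ((1 - Complex.I) / 2)
    simp only [hS, hS'] at h1 h2
    -- The real part a - 1/2 is positive, so the principal logarithm commutes with conjugation here.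
    have hlog : Complex.log ((a : ℂ) - (1 - Complex.I) / 2) =
        (starRingEnd ℂ) (Complex.log ((a : ℂ) - (1 + Complex.I) / 2)) := by
      rw [← Complex.log_conj]
      · congr 1
        simp only [map_sub, map_div₀, map_add, map_one, Complex.conj_ofReal, Complex.conj_I,
          map_ofNat]
        ring
      · refine Complex.slitPlane_arg_ne_pi (Complex.mem_slitPlane_iff.2 (Or.inl ?_))
        simp
        linarith
    set X : ℂ := Complex.log ((a : ℂ) - (1 + Complex.I) / 2) ^ (l + 1) / ((l : ℂ) + 1) with hX
    have hXc : Complex.log ((a : ℂ) - (1 - Complex.I) / 2) ^ (l + 1) / ((l : ℂ) + 1) =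
        (starRingEnd ℂ) X := by
      rw [hlog, hX]
      simp only [map_div₀, map_pow, map_add, map_one, Complex.conj_natCast]
    rw [mul_div_assoc, ← hX] at h1
    rw [mul_div_assoc, hXc] at h2
    have e1 : ∑ k ∈ Finset.range (l + 1), (l.factorial : ℂ) * (-1) ^ k / ((l - k).factorial : ℂ) *
        (A k - B k - Complex.I * C k) =
        ∑ k ∈ Finset.range (l + 1),
          (l.factorial : ℂ) * (-1) ^ k / ((l - k).factorial : ℂ) * (A k - B k) -
        Complex.I * ∑ k ∈ Finset.range (l + 1),
          (l.factorial : ℂ) / ((l - k).factorial : ℂ) * (-1) ^ k * C k := by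
      rw [Finset.mul_sum, ← Finset.sum_sub_distrib]
      exact Finset.sum_congr rfl fun k _ => by ring
    have e2 : ∑ k ∈ Finset.range (l + 1), (l.factorial : ℂ) * (-1) ^ k / ((l - k).factorial : ℂ) *
        (A k - B k + Complex.I * C k) =
        ∑ k ∈ Finset.range (l + 1),
          (l.factorial : ℂ) * (-1) ^ k / ((l - k).factorial : ℂ) * (A k - B k) +
        Complex.I * ∑ k ∈ Finset.range (l + 1),
          (l.factorial : ℂ) / ((l - k).factorial : ℂ) * (-1) ^ k * C k := by
      rw [Finset.mul_sum, ← Finset.sum_add_distrib]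
      exact Finset.sum_congr rfl fun k _ => by ring
    rw [e1] at h1
    rw [e2] at h2
    refine ⟨A, B, C, fun k _ => hA k, fun k _ => hB k, fun k _ => hC k, ?_, ?_⟩
    · rw [show (a : ℂ) - 1 / 2 - Complex.I / 2 = (a : ℂ) - (1 + Complex.I) / 2 by ring, ← hX,
        Complex.re_eq_add_conj]
      -- Averaging cancels the C-sums and leaves Re X; both formulas have the same left side, so
      -- reality of γ_ℓ(a) is not needed.
      linear_combination (1 / 2) * h1 + (1 / 2) * h2
    · rw [add_comm Complex.I 1, mul_div_assoc, ← hX,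
        show (-1 : ℂ) ^ l = (((-1) ^ l : ℝ) : ℂ) by push_cast; rfl, Complex.im_ofReal_mul]
      push_cast
      rw [Complex.im_eq_sub_conj]
      rw [← mul_div_assoc, eq_div_iff (by simp)]
      rw [pow_succ] at h1 h2
      -- Subtracting removes γ_ℓ(a) and A - B, leaving the C-sum against X minus its conjugate.
      linear_combination h2 - h1
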